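/- Conventions. Let $(M,g)$ be a complex Riemannian manifold of dimension $n=2m+\epsilon$, $\epsilon\in\{0,1\}$, $m\ge 2$: $M$ is a complex $n$-manifold and $g$ a non-degenerate holomorphic section of $\odot^2T^*M$. Let $\nabla$ be its Levi-Civita connection, $R(X,Y)Z=\nabla_X\nabla_YZ-\nabla_Y\nabla_XZ-\nabla_{[X,Y]}Z$, $R(X,Y,Z,W)=g(R(X,Y)Z,W)$, $\mathrm{P}=\frac1{n-2}\bigl(\mathrm{Ric}-\frac{\mathrm{Sc}}{2(n-1)}g\bigr)$ the Rho tensor, $C$ the Weyl tensor (the trace-free part of $R$), and $A(X,Y,Z)=(\nabla_Y\mathrm{P})(Z,X)-(\nabla_Z\mathrm{P})(Y,X)$ the Cotton–York tensor. An almost null structure $\mathcal N$ is a holomorphic distribution of totally null $m$-planes; it is integrable in an open set $U$ if both $\mathcal N$ and $\mathcal N^\perp$ are tangent to foliations of $U$. It defines a filtration of $TM$: for $\epsilon=0$, $\mathcal V^{1/2}=\mathcal N\subset\mathcal V^{-1/2}=TM$; for $\epsilon=1$, $\mathcal V^1=\mathcal N\subset\mathcal V^0=\mathcal N^\perp\subset\mathcal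 V^{-1}=TM$ (with $\mathcal V^i=0$ above and $\mathcal V^i=TM$ below these indices, $i\in\mathbb Z+\frac{1-\epsilon}2$). Put $(\mathcal V^*)^i=\mathrm{Ann}(\mathcal V^{1-i})$ and $(\otimes^rT^*M)^k=\sum_{i_1+\dots+i_r=k}(\mathcal V^*)^{i_1}\otimes\cdots\otimes(\mathcal V^*)^{i_r}$, and let $\mathcal C^k$, $\mathcal A^\ell$ be the intersections of $(\otimes^4T^*M)^k$, $(\otimes^3T^*M)^\ell$ with the bundles of tensors with the symmetries of a Weyl tensor and of a Cotton–York tensor, respectively. In dimension four fix an orientation, i.e. a holomorphic $4$-form $\mathrm{vol}$ with $\mathrm{vol}(v_1,\dots,v_4)^2=\det g(v_i,v_j)$; ${}^+C$, ${}^+A$ denote the self-dual parts of $C$, $A$, and ${}^+\mathcal C^k$, ${}^+\mathcal A^\ell$ the self-dual tensors in $\mathcal C^k$, $\mathcal A^\ell$. A Weyl tensor that is a section of $\mathcal C^k$ over $U$ is called otherwise generic if near each point of $U$ there is a holomorphic null frame adapted to $\mathcal N$ in which its components satisfy no homogeneous polynomial relation with constant coefficients on any neighbourhood of the point, except those satisfied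 by all elements of $\mathcal C^k$. Let $\hat g=\Omega^2g$ with $\Omega:M\to\mathbb C$ a nowhere vanishing holomorphic function (in dimension four with orientation $\widehat{\mathrm{vol}}=\Omega^4\,\mathrm{vol}$), let hats denote the objects of $\hat g$, and let $U\subset M$ be open. (I) Assume $n\ge5$. Let $k\in\{0,1,2\}$ if $\epsilon=0$ and $k\in\{0,1,2,3,4\}$ if $\epsilon=1$. If $C$ is a section of $\mathcal C^k$ over $U$, then $A$ is a section of $\mathcal A^{k-1/2}$ (if $\epsilon=0$), respectively of $\mathcal A^{k-1}$ (if $\epsilon=1$), over $U$ if and only if $\hat A$ is a section of $\hat{\mathcal A}^{k-1/2}$, respectively $\hat{\mathcal A}^{k-1}$, over $U$. Moreover $\mathcal N$ is an almost null structure for $\hat g$, and each of the following holds for $g$ if and only if it holds for $\hat g$: $\mathcal N$ is integrable in $U$; the Weyl tensor is a section of $\mathcal C^k$ over $U$; the Weyl tensor is otherwise generic (relative to $\mathcal C^k$) over $U$. Consequently each of the following Goldberg–Sachs statements holds for $g$ if and only if it holds for $\hat g$: (i) if the Weyl tensor is a section of $\mathcal C^k$ over $U$, then the Cotton–York tensor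 is a section of $\mathcal A^{k-(3+\epsilon)/2}$ over $U$, and even of $\mathcal A^{k-(1+\epsilon)/2}$ if in addition $\mathcal N$ is integrable in $U$; (ii) if the Weyl tensor is an otherwise generic section of $\mathcal C^k$ over $U$ and the Cotton–York tensor is a section of $\mathcal A^{k-(1+\epsilon)/2}$ over $U$, then $\mathcal N$ is integrable in $U$. (II) Assume $n=4$ and $\mathcal N$ self-dual. Let $k\in\{0,1,2\}$. If ${}^+C$ is a section of ${}^+\mathcal C^k$ over $U$, then ${}^+A$ is a section of ${}^+\mathcal A^{k-1/2}$ over $U$ if and only if the same holds for $\hat g$. Moreover $\mathcal N$ is a self-dual almost null structure for $\hat g$, and each of the following holds for $g$ if and only if it holds for $\hat g$: $\mathcal N$ is integrable in $U$; ${}^+C$ is a section of ${}^+\mathcal C^k$ over $U$; $(1)_k$: ${}^+C$ is a section of ${}^+\mathcal C^k$ but not of ${}^+\mathcal C^{k+1}$ over $U$. Write $(2)$ for "$\mathcal N$ is integrable in $U$" and $(3)_k$ for "${}^+A$ is a section of ${}^+\mathcal A^{k-1/2}$ over $U$". Consequently the Goldberg–Sachs implications (a) $(1)_k\,\&\,(2)\Rightarrow(3)_k$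 and (b) $(1)_k\,\&\,(3)_k\Rightarrow(2)$ hold for $g$ if and only if they hold for $\hat g$. For (c) $(2)\,\&\,(3)_0\Rightarrow\bigl((1)_0\text{ or }(1)_1\text{ or }(1)_2\bigr)$: hypothesis and conclusion hold together for $g$ if and only if they hold together for $\hat g$; and when ${}^+C$ is a section of ${}^+\mathcal C^0$ over $U$, the hypothesis of (c) holds for $g$ if and only if it holds for $\hat g$, and so does the implication (c). -/

import Mathlib

open scoped Manifold ContDiff Topology

noncomputable section

namespace NullGeometry

/-! ### Curvature of a holomorphic metric in local coordinates

`G y i j` are the components of a metric in holomorphic coordinates `y` on an open subset of `ℂⁿ`. -/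

/-- The partial derivative `∂ᵢ f` at `y`. -/
def pderiv {n : ℕ} (i : Fin n) (f : (Fin n → ℂ) → ℂ) (y : Fin n → ℂ) : ℂ :=
  fderiv ℂ f y (Pi.single i 1)

/-- Christoffel symbols `Γᵏᵢⱼ` of the Levi-Civita connection, `∇_{∂ᵢ} ∂ⱼ = Γᵏᵢⱼ ∂ₖ`. -/
def christoffel {n : ℕ} (G : (Fin n → ℂ) → Matrix (Fin n) (Fin n) ℂ) (k i j : Fin n)
    (y : Fin n → ℂ) : ℂ :=
  (1 / 2) * ∑ l, (G y)⁻¹ k l *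
    (pderiv i (fun z => G z j l) y + pderiv j (fun z => G z i l) y
      - pderiv l (fun z => G z i j) y)

/-- `R(∂ᵢ, ∂ⱼ, ∂ₖ, ∂ₗ) = g(∇ᵢ∇ⱼ∂ₖ - ∇ⱼ∇ᵢ∂ₖ, ∂ₗ)`. -/
def riemannCoord {n : ℕ} (G : (Fin n → ℂ) → Matrix (Fin n) (Fin n) ℂ) (i j k l : Fin n)
    (y : Fin n → ℂ) : ℂ :=
  ∑ a, G y a l *
    (pderiv i (christoffel G a j k) y - pderiv j (christoffel G a i k) y
      + ∑ b, (christoffel G a i b y * christoffel G b j k y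
        - christoffel G a j b y * christoffel G b i k y))

/-- The Ricci tensor, `Ric(Y, Z) = tr (X ↦ R(X, Y) Z)`. -/
def ricciCoord {n : ℕ} (G : (Fin n → ℂ) → Matrix (Fin n) (Fin n) ℂ) (j k : Fin n)
    (y : Fin n → ℂ) : ℂ :=
  ∑ i, ∑ l, (G y)⁻¹ i l * riemannCoord G i j k l y

/-- The scalar curvature. -/
def scalarCoord {n : ℕ} (G : (Fin n → ℂ) → Matrix (Fin n) (Fin n) ℂ) (y : Fin n → ℂ) : ℂ :=
  ∑ j, ∑ k, (G y)⁻¹ j k * ricciCoord G j k y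

/-- The Rho (Schouten) tensor. -/
def rhoCoord {n : ℕ} (G : (Fin n → ℂ) → Matrix (Fin n) (Fin n) ℂ) (i j : Fin n)
    (y : Fin n → ℂ) : ℂ :=
  (1 / ((n : ℂ) - 2)) *
    (ricciCoord G i j y - scalarCoord G y / (2 * ((n : ℂ) - 1)) * G y i j)

/-- The Weyl tensor: the Riemann tensor minus its Rho part. -/
def weylCoord {n : ℕ} (G : (Fin n → ℂ) → Matrix (Fin n) (Fin n) ℂ) (i j k l : Fin n)
    (y : Fin n → ℂ) : ℂ :=
  riemannCoord G i j k l y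
    + G y i k * rhoCoord G j l y - G y i l * rhoCoord G j k y
    - G y j k * rhoCoord G i l y + G y j l * rhoCoord G i k y

/-- `(∇_{∂ᵢ} Ρ)(∂ⱼ, ∂ₖ)`. -/
def covRhoCoord {n : ℕ} (G : (Fin n → ℂ) → Matrix (Fin n) (Fin n) ℂ) (i j k : Fin n)
    (y : Fin n → ℂ) : ℂ :=
  pderiv i (rhoCoord G j k) y
    - ∑ a, (christoffel G a i j y * rhoCoord G a k y + christoffel G a i k y * rhoCoord G j a y)

/-- The Cotton–York tensor `A(X, Y, Z) = (∇_Y Ρ)(Z, X) - (∇_Z Ρ)(Y, X)`. -/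
def cottonCoord {n : ℕ} (G : (Fin n → ℂ) → Matrix (Fin n) (Fin n) ℂ) (i j k : Fin n)
    (y : Fin n → ℂ) : ℂ :=
  covRhoCoord G j k i y - covRhoCoord G k j i y

/-! ### Linear algebra of null subspaces: filtrations, Weyl and Cotton–York symmetries

`V` is a complex vector space of dimension `n = 2m + ε`, `ε ∈ {0, 1}`, so `m = n / 2` and
`ε = n % 2`.  Covariant `r`-tensors on `V` are functions `(Fin r → V) → ℂ`. -/

section Algebra

variable {V : Type*} [AddCommGroup V] [Module ℂ V]

/-- The Gram matrix of a bilinear form in a basis. -/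
def gram {n : ℕ} (B : LinearMap.BilinForm ℂ V) (b : Module.Basis (Fin n) ℂ V) :
    Matrix (Fin n) (Fin n) ℂ :=
  Matrix.of fun i j => B (b i) (b j)

/-- The indices of the filtrations: `i ∈ ℤ + (1 - ε) / 2`. -/
def IsWeight (n : ℕ) (i : ℚ) : Prop :=
  ∃ z : ℤ, i = z + (1 - ((n % 2 : ℕ) : ℚ)) / 2

/-- The filtration `Vⁱ` of `V` determined by a maximal totally null subspace `N`.
For `ε = 0` it reads `V^{1/2} = N ⊂ V^{-1/2} = V`, and for `ε = 1` it reads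
`V¹ = N ⊂ V⁰ = N^⊥ ⊂ V⁻¹ = V`; it is `0` above and `V` below these indices. -/
def nullFiltration (n : ℕ) (B : LinearMap.BilinForm ℂ V) (N : Submodule ℂ V) (i : ℚ) :
    Submodule ℂ V :=
  if i ≤ -(1 + ((n % 2 : ℕ) : ℚ)) / 2 then ⊤
  else if i ≤ 0 then B.orthogonal N
  else if i ≤ (1 + ((n % 2 : ℕ) : ℚ)) / 2 then N
  else ⊥

/-- The dual filtration: `(V*)ⁱ` is the annihilator of `V^{1 - i}`. -/
def dualFiltration (n : ℕ) (B : LinearMap.BilinForm ℂ V) (N : Submodule ℂ V) (i : ℚ) :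
    Submodule ℂ (Module.Dual ℂ V) :=
  (nullFiltration n B N (1 - i)).dualAnnihilator

/-- The induced filtration of the tensor power: `(⊗ʳ V*)ᵏ` is the sum of the
`(V*)^{i₁} ⊗ ⋯ ⊗ (V*)^{iᵣ}` over all indices with `i₁ + ⋯ + iᵣ = k`. -/
def tensorFiltration (n r : ℕ) (B : LinearMap.BilinForm ℂ V) (N : Submodule ℂ V) (k : ℚ) :
    Submodule ℂ ((Fin r → V) → ℂ) :=
  Submodule.span ℂ
    {T | ∃ (i : Fin r → ℚ) (α : Fin r → Module.Dual ℂ V),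
      (∀ j, IsWeight n (i j)) ∧ ∑ j, i j = k ∧ (∀ j, α j ∈ dualFiltration n B N (i j)) ∧
      T = fun X => ∏ j, α j (X j)}

/-- The symmetries of a Weyl tensor; `b` is any basis of `V`, used for the trace. -/
structure IsWeylType {n : ℕ} (B : LinearMap.BilinForm ℂ V) (b : Module.Basis (Fin n) ℂ V)
    (T : (Fin 4 → V) → ℂ) : Prop where
  skew_left : ∀ X Y Z W, T ![Y, X, Z, W] = -T ![X, Y, Z, W]
  skew_right : ∀ X Y Z W, T ![X, Y, W, Z] = -T ![X, Y, Z, W]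
  pair_symm : ∀ X Y Z W, T ![Z, W, X, Y] = T ![X, Y, Z, W]
  cyclic : ∀ X Y Z W, T ![X, Y, Z, W] + T ![Y, Z, X, W] + T ![Z, X, Y, W] = 0
  trace_free : ∀ Y Z, ∑ i, ∑ l, (gram B b)⁻¹ i l * T ![b i, Y, Z, b l] = 0

/-- The symmetries of a Cotton–York tensor (a `2`-form valued `1`-form). -/
structure IsCottonType {n : ℕ} (B : LinearMap.BilinForm ℂ V) (b : Module.Basis (Fin n) ℂ V)
    (T : (Fin 3 → V) → ℂ) : Prop where
  skew : ∀ X Y Z, T ![X, Z, Y] = -T ![X, Y, Z]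
  cyclic : ∀ X Y Z, T ![X, Y, Z] + T ![Y, Z, X] + T ![Z, X, Y] = 0
  trace_free : ∀ Z, ∑ i, ∑ j, (gram B b)⁻¹ i j * T ![b i, b j, Z] = 0

/-- The member `𝒞ᵏ` of the filtration of the space of tensors with Weyl symmetries. -/
def weylSpace {n : ℕ} (B : LinearMap.BilinForm ℂ V) (b : Module.Basis (Fin n) ℂ V)
    (N : Submodule ℂ V) (k : ℚ) : Set ((Fin 4 → V) → ℂ) :=
  {T | T ∈ tensorFiltration n 4 B N k ∧ IsWeylType B b T}

/-- The member `𝒜ˡ` of the filtration of the space of tensors with Cotton–York symmetries. -/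
def cottonSpace {n : ℕ} (B : LinearMap.BilinForm ℂ V) (b : Module.Basis (Fin n) ℂ V)
    (N : Submodule ℂ V) (l : ℚ) : Set ((Fin 3 → V) → ℂ) :=
  {T | T ∈ tensorFiltration n 3 B N l ∧ IsCottonType B b T}

/-- The Hodge operator on `2`-forms in dimension four,
`(*η)(X, Y) = ½ vol(X, Y, eⁱ, eʲ) η(eᵢ, eⱼ)` with indices raised by the metric. -/
def hodge (B : LinearMap.BilinForm ℂ V) (b : Module.Basis (Fin 4) ℂ V)
    (vol : V [⋀^Fin 4]→ₗ[ℂ] ℂ) (η : V → V → ℂ) : V → V → ℂ := fun X Y =>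
  (1 / 2) * ∑ i, ∑ j, ∑ k, ∑ l, (gram B b)⁻¹ i k * (gram B b)⁻¹ j l *
    vol ![X, Y, b i, b j] * η (b k) (b l)

/-- The Hodge operator applied to the pair of arguments `s`, `t` of a tensor. -/
def hodgeSlots {r : ℕ} (B : LinearMap.BilinForm ℂ V) (b : Module.Basis (Fin 4) ℂ V)
    (vol : V [⋀^Fin 4]→ₗ[ℂ] ℂ) (s t : Fin r) (T : (Fin r → V) → ℂ) : (Fin r → V) → ℂ :=
  fun X => hodge B b vol
    (fun Y Z => T (Function.update (Function.update X s Y) t Z)) (X s) (X t)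

/-- The self-dual part of a tensor with respect to its arguments `s`, `t`. -/
def selfDualPart {r : ℕ} (B : LinearMap.BilinForm ℂ V) (b : Module.Basis (Fin 4) ℂ V)
    (vol : V [⋀^Fin 4]→ₗ[ℂ] ℂ) (s t : Fin r) (T : (Fin r → V) → ℂ) : (Fin r → V) → ℂ :=
  fun X => (1 / 2) * (T X + hodgeSlots B b vol s t T X)

/-- `⁺𝒞ᵏ`: the self-dual tensors in `𝒞ᵏ`, in dimension four. -/
def sdWeylSpace (B : LinearMap.BilinForm ℂ V) (b : Module.Basis (Fin 4) ℂ V)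
    (vol : V [⋀^Fin 4]→ₗ[ℂ] ℂ) (N : Submodule ℂ V) (k : ℚ) : Set ((Fin 4 → V) → ℂ) :=
  {T | T ∈ weylSpace B b N k ∧ hodgeSlots B b vol 2 3 T = T}

/-- `⁺𝒜ˡ`: the tensors in `𝒜ˡ` whose `2`-form part is self-dual, in dimension four. -/
def sdCottonSpace (B : LinearMap.BilinForm ℂ V) (b : Module.Basis (Fin 4) ℂ V)
    (vol : V [⋀^Fin 4]→ₗ[ℂ] ℂ) (N : Submodule ℂ V) (l : ℚ) : Set ((Fin 3 → V) → ℂ) :=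
  {T | T ∈ cottonSpace B b N l ∧ hodgeSlots B b vol 1 2 T = T}

/-- Labels of a null basis `{ξ_μ, ξ̃_μ, ξ₀}` (`ξ₀` only for odd `n`). -/
abbrev NullIndex (n : ℕ) : Type := Fin (n / 2) ⊕ Fin (n / 2) ⊕ Fin (n % 2)

/-- The metric in a null basis: `g(ξ_μ, ξ̃_ν) = δ_μν`, `g(ξ₀, ξ₀) = 1`, all others zero. -/
def nullForm {n : ℕ} : NullIndex n → NullIndex n → ℂ
  | .inl a, .inr (.inl b) => if a = b then 1 else 0
  | .inr (.inl a), .inl b => if a = b then 1 else 0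
  | .inr (.inr _), .inr (.inr _) => 1
  | _, _ => 0

/-- A null basis of `V` adapted to `N = span {ξ_μ}`. -/
def IsAdaptedBasis {n : ℕ} (B : LinearMap.BilinForm ℂ V) (N : Submodule ℂ V)
    (e : NullIndex n → V) : Prop :=
  (∀ a c, B (e a) (e c) = nullForm a c) ∧
    Submodule.span ℂ (Set.range fun μ : Fin (n / 2) => e (.inl μ)) = N

/-- The components of a tensor in a family of vectors. -/
def components {r : ℕ} {ι : Type*} (T : (Fin r → V) → ℂ) (e : ι → V) : (Fin r → ι) → ℂ :=
  fun I => T fun j => e (I j)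

end Algebra

/-! ### Complex Riemannian manifolds and almost null structures -/

section Manifold

variable {n : ℕ} {M : Type*} [TopologicalSpace M] [ChartedSpace (Fin n → ℂ) M]

/-- The holomorphic tangent space at `p`. -/
abbrev Tan (n : ℕ) {M : Type*} [TopologicalSpace M] [ChartedSpace (Fin n → ℂ) M] (p : M) : Type :=
  TangentSpace 𝓘(ℂ, Fin n → ℂ) p

/-- The chart at `p`. -/
abbrev chart (n : ℕ) {M : Type*} [TopologicalSpace M] [ChartedSpace (Fin n → ℂ) M] (p : M) :
    PartialEquiv M (Fin n → ℂ) :=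
  extChartAt 𝓘(ℂ, Fin n → ℂ) p

/-- The coordinate vector field `∂ᵢ` of the chart at `p`, at the point with coordinates `y`. -/
def coordVec (p : M) (y : Fin n → ℂ) (i : Fin n) : Tan n ((chart n p).symm y) :=
  mfderiv 𝓘(ℂ, Fin n → ℂ) 𝓘(ℂ, Fin n → ℂ) (chart n p).symm y (Pi.single i (1 : ℂ) : Fin n → ℂ)

/-- The basis of `T_p M` given by the coordinates of the chart at `p`
(by definition, Mathlib's tangent space at `p` is `ℂⁿ` via this chart). -/
def coordBasis (p : M) : Module.Basis (Fin n) ℂ (Tan n p) :=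
  (Pi.basisFun ℂ (Fin n) : Module.Basis (Fin n) ℂ (Fin n → ℂ))

/-- The components of a field of bilinear forms in the coordinates of the chart at `p`. -/
def coordMatrix (g : ∀ p : M, LinearMap.BilinForm ℂ (Tan n p)) (p : M) (y : Fin n → ℂ) :
    Matrix (Fin n) (Fin n) ℂ :=
  Matrix.of fun i j => g ((chart n p).symm y) (coordVec p y i) (coordVec p y j)

variable (n M) in
/-- A holomorphic metric on a complex manifold of dimension `n`. -/
structure HolomorphicMetric where
  val : ∀ p : M, LinearMap.BilinForm ℂ (Tan n p)
  symm : ∀ (p : M) (u v : Tan n p), val p u v = val p v u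
  nondegenerate : ∀ (p : M) (u : Tan n p), (∀ v, val p u v = 0) → u = 0
  holomorphic : ∀ (p : M) (i j : Fin n),
    ContDiffOn ℂ ω (fun y => coordMatrix val p y i j) (chart n p).target

/-- The Weyl tensor at `p`. -/
def weyl (g : HolomorphicMetric n M) (p : M) : (Fin 4 → Tan n p) → ℂ := fun X =>
  ∑ i, ∑ j, ∑ k, ∑ l, weylCoord (coordMatrix g.val p) i j k l (chart n p p) *
    ((coordBasis p).repr (X 0) i * (coordBasis p).repr (X 1) j *
      (coordBasis p).repr (X 2) k * (coordBasis p).repr (X 3) l)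

/-- The Cotton–York tensor at `p`. -/
def cotton (g : HolomorphicMetric n M) (p : M) : (Fin 3 → Tan n p) → ℂ := fun X =>
  ∑ i, ∑ j, ∑ k, cottonCoord (coordMatrix g.val p) i j k (chart n p p) *
    ((coordBasis p).repr (X 0) i * (coordBasis p).repr (X 1) j * (coordBasis p).repr (X 2) k)

/-- `g' = Ω² g` for a nowhere vanishing holomorphic function `Ω`. -/
structure IsConformalChange (g g' : HolomorphicMetric n M) (Ω : M → ℂ) : Prop where
  holomorphic : ContMDiff 𝓘(ℂ, Fin n → ℂ) 𝓘(ℂ, ℂ) ω Ω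
  ne_zero : ∀ p, Ω p ≠ 0
  eq : ∀ p, g'.val p = Ω p ^ 2 • g.val p

variable [IsManifold 𝓘(ℂ, Fin n → ℂ) ω M]

/-- A holomorphic vector field near `p`. -/
def HolomorphicAt (X : ∀ q : M, Tan n q) (p : M) : Prop :=
  ContMDiffAt 𝓘(ℂ, Fin n → ℂ) (𝓘(ℂ, Fin n → ℂ)).tangent ω
    (fun q => (⟨q, X q⟩ : TangentBundle 𝓘(ℂ, Fin n → ℂ) M)) p

/-- An almost null structure: a holomorphic distribution of totally null `m`-planes,
`m = n / 2`. -/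
structure IsAlmostNull (g : HolomorphicMetric n M) (N : ∀ p : M, Submodule ℂ (Tan n p)) :
    Prop where
  finrank_eq : ∀ p, Module.finrank ℂ (N p) = n / 2
  null : ∀ p, ∀ u ∈ N p, ∀ v ∈ N p, g.val p u v = 0
  holomorphic : ∀ p, ∃ X : Fin (n / 2) → ∀ q : M, Tan n q,
    (∀ μ, HolomorphicAt (X μ) p) ∧
      ∀ᶠ q in 𝓝 p, Submodule.span ℂ (Set.range fun μ => X μ q) = N q

/-- A distribution is integrable in `U` if near each point of `U` there are holomorphic
coordinates in which it is constant, i.e. it is tangent to the leaves of a foliation. -/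
def IsFoliated (D : ∀ p : M, Submodule ℂ (Tan n p)) (U : Set M) : Prop :=
  ∀ p ∈ U, ∃ φ ∈ IsManifold.maximalAtlas 𝓘(ℂ, Fin n → ℂ) ω M, p ∈ φ.source ∧
    ∃ W : Submodule ℂ (Fin n → ℂ), ∀ q ∈ φ.source ∩ U, ∀ v : Tan n q,
      v ∈ D q ↔
        (mfderiv 𝓘(ℂ, Fin n → ℂ) 𝓘(ℂ, Fin n → ℂ) φ q v : Fin n → ℂ) ∈ W

/-- Integrability of an almost null structure in `U`: both `N` and `N^⊥` are integrable. -/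
def IsNullIntegrable (g : HolomorphicMetric n M) (N : ∀ p : M, Submodule ℂ (Tan n p))
    (U : Set M) : Prop :=
  IsFoliated N U ∧ IsFoliated (fun p => (g.val p).orthogonal (N p)) U

/-- The Weyl tensor is a section of `𝒞ᵏ` over `U`. -/
def WeylIn (g : HolomorphicMetric n M) (N : ∀ p : M, Submodule ℂ (Tan n p)) (U : Set M)
    (k : ℚ) : Prop :=
  ∀ p ∈ U, weyl g p ∈ weylSpace (g.val p) (coordBasis p) (N p) k

/-- The Cotton–York tensor is a section of `𝒜ˡ` over `U`. -/
def CottonIn (g : HolomorphicMetric n M) (N : ∀ p : M, Submodule ℂ (Tan n p)) (U : Set M)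
    (l : ℚ) : Prop :=
  ∀ p ∈ U, cotton g p ∈ cottonSpace (g.val p) (coordBasis p) (N p) l

/-- The Weyl tensor, as a section of `𝒞ᵏ` over `U`, is otherwise generic: near each point of `U`
there is an adapted null frame in which the components of the Weyl tensor satisfy no homogeneous
polynomial relation with constant coefficients other than those satisfied by all elements of
`𝒞ᵏ`. -/
def IsGeneric (g : HolomorphicMetric n M) (N : ∀ p : M, Submodule ℂ (Tan n p)) (U : Set M)
    (k : ℚ) : Prop :=
  ∀ p ∈ U, ∃ e : NullIndex n → ∀ q : M, Tan n q,
    (∀ a, HolomorphicAt (e a) p) ∧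
    (∀ᶠ q in 𝓝 p, IsAdaptedBasis (g.val q) (N q) fun a => e a q) ∧
    ∀ (d : ℕ) (F : MvPolynomial (Fin 4 → NullIndex n) ℂ), F.IsHomogeneous d →
      (∀ᶠ q in 𝓝 p, MvPolynomial.eval (components (weyl g q) fun a => e a q) F = 0) →
      ∀ T ∈ weylSpace (g.val p) (coordBasis p) (N p) k,
        MvPolynomial.eval (components T fun a => e a p) F = 0

/-- If the Weyl tensor is a section of `𝒞ᵏ`, then the Cotton–York tensor is a section of
`𝒜^{k - (3 + ε)/2}`, and of `𝒜^{k - (1 + ε)/2}` if the almost null structure is integrable. -/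
def CottonDegeneracy (g : HolomorphicMetric n M) (N : ∀ p : M, Submodule ℂ (Tan n p))
    (U : Set M) (k : ℚ) : Prop :=
  (WeylIn g N U k → CottonIn g N U (k - (3 + ((n % 2 : ℕ) : ℚ)) / 2)) ∧
  (WeylIn g N U k → IsNullIntegrable g N U → CottonIn g N U (k - (1 + ((n % 2 : ℕ) : ℚ)) / 2))

/-- The Goldberg–Sachs implication in dimension at least five: if the Weyl tensor is an otherwise
generic section of `𝒞ᵏ` and the Cotton–York tensor is a section of `𝒜^{k - (1 + ε)/2}`, then the
almost null structure is integrable. -/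
def GoldbergSachs (g : HolomorphicMetric n M) (N : ∀ p : M, Submodule ℂ (Tan n p))
    (U : Set M) (k : ℚ) : Prop :=
  WeylIn g N U k → IsGeneric g N U k → CottonIn g N U (k - (1 + ((n % 2 : ℕ) : ℚ)) / 2) →
    IsNullIntegrable g N U

end Manifold

/-! ### Dimension four -/

section FourDim

variable {M : Type*} [TopologicalSpace M] [ChartedSpace (Fin 4 → ℂ) M]

/-- An orientation of a four-dimensional complex Riemannian manifold: a holomorphic `4`-form with
`vol(v₁, …, v₄)² = det g(vᵢ, vⱼ)`. -/
structure HolOrientation (g : HolomorphicMetric 4 M) where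
  vol : ∀ p : M, (Tan 4 p) [⋀^Fin 4]→ₗ[ℂ] ℂ
  sq : ∀ (p : M) (v : Fin 4 → Tan 4 p),
    vol p v ^ 2 = (Matrix.of fun i j => g.val p (v i) (v j)).det
  holomorphic : ∀ p : M,
    ContDiffOn ℂ ω (fun y => vol ((chart 4 p).symm y) (coordVec p y)) (chart 4 p).target

/-- A distribution of `2`-planes is self-dual if `*(u ∧ v) = u ∧ v` for all `u`, `v` in it,
vectors being identified with `1`-forms by the metric. -/
def IsSelfDual {g : HolomorphicMetric 4 M} (o : HolOrientation g)
    (N : ∀ p : M, Submodule ℂ (Tan 4 p)) : Prop :=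
  ∀ p, ∀ u ∈ N p, ∀ v ∈ N p,
    hodge (g.val p) (coordBasis p) (o.vol p)
      (fun X Y => g.val p u X * g.val p v Y - g.val p u Y * g.val p v X) =
    fun X Y => g.val p u X * g.val p v Y - g.val p u Y * g.val p v X

/-- The self-dual part of the Weyl tensor is a section of `⁺𝒞ᵏ` over `U`. -/
def SDWeylIn {g : HolomorphicMetric 4 M} (o : HolOrientation g)
    (N : ∀ p : M, Submodule ℂ (Tan 4 p)) (U : Set M) (k : ℚ) : Prop :=
  ∀ p ∈ U, selfDualPart (g.val p) (coordBasis p) (o.vol p) 2 3 (weyl g p) ∈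
    sdWeylSpace (g.val p) (coordBasis p) (o.vol p) (N p) k

/-- The self-dual part of the Cotton–York tensor is a section of `⁺𝒜ˡ` over `U`. -/
def SDCottonIn {g : HolomorphicMetric 4 M} (o : HolOrientation g)
    (N : ∀ p : M, Submodule ℂ (Tan 4 p)) (U : Set M) (l : ℚ) : Prop :=
  ∀ p ∈ U, selfDualPart (g.val p) (coordBasis p) (o.vol p) 1 2 (cotton g p) ∈
    sdCottonSpace (g.val p) (coordBasis p) (o.vol p) (N p) l

/-- The self-dual part of the Weyl tensor is a section of `⁺𝒞ᵏ` over `U` which does not degenerate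
to a section of `⁺𝒞ᵏ⁺¹` over `U`. -/
def SDWeylExactly {g : HolomorphicMetric 4 M} (o : HolOrientation g)
    (N : ∀ p : M, Submodule ℂ (Tan 4 p)) (U : Set M) (k : ℚ) : Prop :=
  SDWeylIn o N U k ∧ ¬ SDWeylIn o N U (k + 1)

/-- Part (a) of the four-dimensional Goldberg–Sachs theorem. -/
def GoldbergSachsA {g : HolomorphicMetric 4 M} (o : HolOrientation g)
    (N : ∀ p : M, Submodule ℂ (Tan 4 p)) (U : Set M) (k : ℚ) : Prop :=
  SDWeylExactly o N U k → IsNullIntegrable g N U → SDCottonIn o N U (k - 1 / 2)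

/-- Part (b) of the four-dimensional Goldberg–Sachs theorem. -/
def GoldbergSachsB {g : HolomorphicMetric 4 M} (o : HolOrientation g)
    (N : ∀ p : M, Submodule ℂ (Tan 4 p)) (U : Set M) (k : ℚ) : Prop :=
  SDWeylExactly o N U k → SDCottonIn o N U (k - 1 / 2) → IsNullIntegrable g N U

/-- The hypothesis of part (c) of the four-dimensional Goldberg–Sachs theorem. -/
def HypothesisC {g : HolomorphicMetric 4 M} (o : HolOrientation g)
    (N : ∀ p : M, Submodule ℂ (Tan 4 p)) (U : Set M) : Prop :=
  IsNullIntegrable g N U ∧ SDCottonIn o N U (-1 / 2)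

/-- The conclusion of part (c) of the four-dimensional Goldberg–Sachs theorem. -/
def ConclusionC {g : HolomorphicMetric 4 M} (o : HolOrientation g)
    (N : ∀ p : M, Submodule ℂ (Tan 4 p)) (U : Set M) : Prop :=
  ∃ k : ℕ, k ≤ 2 ∧ SDWeylExactly o N U k

end FourDim

end NullGeometry

end

open NullGeometry

open scoped Manifold ContDiff Topology

noncomputable section

/-! Write υ for d log Ω, with gradient υ^l taken with respect to g. The whole statement rests on two
transformation laws: as covariant tensors, Ĉ = Ω² C, and Â_{ijk} = A_{ijk} + C_{jkil} υ^l. Both hold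
for n ≥ 3 and are proved in coordinates (`IsLocalConformal.weylCoord_eq`,
`IsLocalConformal.cottonCoord_eq`).

The filtrations depend only on N and N^⊥, which g and ĝ share, and trace-freeness is insensitive to
scale; so the spaces 𝒞ᵏ and 𝒜ˡ are the same for both metrics, and so is integrability. Hence a
condition on C is invariant as soon as it survives multiplication by a nowhere vanishing function.
Genericity does: its polynomial relations are homogeneous, and an adapted frame can be rescaled by
Ω⁻¹.

The Cotton–York tensor really changes, but by a contraction of C with a vector. A nonzero covector
has weight at most (1 + ε)/2, so contracting one slot lowers the weight by at most that amount, and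
C in 𝒞ᵏ puts the error term in 𝒜^{k-(1+ε)/2} and in every later step down
(`contractLast_mem_cottonSpace`). Membership of A and of Â is therefore equivalent at exactly the
levels occurring in the Goldberg–Sachs statements.

In dimension four the Hodge operator on 2-forms is conformally invariant. By pair symmetry the
contracted slot can be moved away from the pair on which it acts, so taking self-dual parts commutes
with the contraction, and the same argument applies to ⁺C and ⁺A. For (c), the conclusion itself
already forces ⁺C into ⁺𝒞⁰, which is what transferring the hypothesis requires. -/

namespace NullGeometry

/-! ### Partial derivatives -/

section Partial

variable {n : ℕ} {f h : (Fin n → ℂ) → ℂ} {y : Fin n → ℂ}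

/-- `f` is analytic at `y`, with partial derivative `∂ᵢ f = c` there. -/
def HasPderiv (i : Fin n) (f : (Fin n → ℂ) → ℂ) (c : ℂ) (y : Fin n → ℂ) : Prop :=
  AnalyticAt ℂ f y ∧ pderiv i f y = c

theorem hasPderiv (i : Fin n) (hf : AnalyticAt ℂ f y) : HasPderiv i f (pderiv i f y) y :=
  ⟨hf, rfl⟩

theorem HasPderiv.add {i : Fin n} {c d : ℂ} (hf : HasPderiv i f c y) (hh : HasPderiv i h d y) :
    HasPderiv i (fun z => f z + h z) (c + d) y := by
  refine ⟨hf.1.add hh.1, ?_⟩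
  rw [← hf.2, ← hh.2]
  simp [pderiv, fderiv_fun_add hf.1.differentiableAt hh.1.differentiableAt]

theorem HasPderiv.sub {i : Fin n} {c d : ℂ} (hf : HasPderiv i f c y) (hh : HasPderiv i h d y) :
    HasPderiv i (fun z => f z - h z) (c - d) y := by
  refine ⟨hf.1.sub hh.1, ?_⟩
  rw [← hf.2, ← hh.2]
  simp [pderiv, fderiv_fun_sub hf.1.differentiableAt hh.1.differentiableAt]

theorem HasPderiv.mul {i : Fin n} {c d : ℂ} (hf : HasPderiv i f c y) (hh : HasPderiv i h d y) :
    HasPderiv i (fun z => f z * h z) (c * h y + f y * d) y := by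
  refine ⟨hf.1.mul hh.1, ?_⟩
  rw [← hf.2, ← hh.2]
  simp [pderiv, fderiv_fun_mul hf.1.differentiableAt hh.1.differentiableAt]
  ring

theorem HasPderiv.const_mul {i : Fin n} {d : ℂ} (c : ℂ) (hf : HasPderiv i f d y) :
    HasPderiv i (fun z => c * f z) (c * d) y := by
  refine ⟨analyticAt_const.mul hf.1, ?_⟩
  rw [← hf.2]
  simp [pderiv, fderiv_const_mul hf.1.differentiableAt]

theorem HasPderiv.inv {i : Fin n} {d : ℂ} (hf : HasPderiv i f d y) (h0 : f y ≠ 0) :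
    HasPderiv i (fun z => (f z)⁻¹) (-d / f y ^ 2) y := by
  refine ⟨hf.1.inv h0, ?_⟩
  rw [← hf.2]
  have := ((hasDerivAt_inv h0).comp_hasFDerivAt y hf.1.differentiableAt.hasFDerivAt).fderiv
  simp only [pderiv]
  erw [this]
  simp; ring

theorem HasPderiv.sum {i : Fin n} {ι : Type*} [Fintype ι] {F : ι → (Fin n → ℂ) → ℂ} {c : ι → ℂ}
    (hF : ∀ a, HasPderiv i (F a) (c a) y) : HasPderiv i (fun z => ∑ a, F a z) (∑ a, c a) y := by
  refine ⟨Finset.analyticAt_fun_sum _ fun a _ => (hF a).1, ?_⟩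
  simp [pderiv, fderiv_fun_sum fun a _ => (hF a).1.differentiableAt, ← fun a => (hF a).2]

theorem pderiv_congr (i : Fin n) {S : Set (Fin n → ℂ)} (hS : IsOpen S) (hy : y ∈ S)
    (hfh : ∀ z ∈ S, f z = h z) : pderiv i f y = pderiv i h y := by
  have : f =ᶠ[𝓝 y] h := Filter.eventually_of_mem (hS.mem_nhds hy) hfh
  simp [pderiv, this.fderiv_eq]

theorem analyticAt_pderiv (i : Fin n) (hf : AnalyticAt ℂ f y) : AnalyticAt ℂ (pderiv i f) y :=
  ((ContinuousLinearMap.apply ℂ ℂ (Pi.single i 1 : Fin n → ℂ)).analyticAt _).comp hf.fderiv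

theorem pderiv_comm (i j : Fin n) (hf : AnalyticAt ℂ f y) :
    pderiv i (pderiv j f) y = pderiv j (pderiv i f) y := by
  have key : ∀ a b : Fin n, pderiv a (pderiv b f) y =
      fderiv ℂ (fderiv ℂ f) y (Pi.single a 1) (Pi.single b 1) := by
    intro a b
    have h1 : pderiv b f = fun z => (fderiv ℂ f z) (Pi.single b 1) := rfl
    rw [pderiv, h1, fderiv_clm_apply hf.fderiv.differentiableAt (differentiableAt_const _)]
    simp
  rw [key, key]
  exact (ContDiffAt.isSymmSndFDerivAt_of_omega hf.contDiffAt) _ _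

end Partial

/-! ### Local metrics -/

/-- `G` is an analytic, symmetric, non-degenerate matrix field on the open set `S`. -/
structure IsLocalMetric {n : ℕ} (G : (Fin n → ℂ) → Matrix (Fin n) (Fin n) ℂ)
    (S : Set (Fin n → ℂ)) : Prop where
  isOpen : IsOpen S
  analytic : ∀ y ∈ S, ∀ i j, AnalyticAt ℂ (fun z => G z i j) y
  symm : ∀ y i j, G y i j = G y j i
  isUnit_det : ∀ y ∈ S, IsUnit (G y).det

theorem analyticAt_det {n : ℕ} {A : (Fin n → ℂ) → Matrix (Fin n) (Fin n) ℂ} {y : Fin n → ℂ}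
    (hA : ∀ i j, AnalyticAt ℂ (fun z => A z i j) y) : AnalyticAt ℂ (fun z => (A z).det) y := by
  simp only [Matrix.det_apply']
  refine Finset.analyticAt_fun_sum _ fun σ _ => analyticAt_const.mul ?_
  exact Finset.analyticAt_fun_prod _ fun i _ => hA _ _

theorem analyticAt_inv {n : ℕ} {A : (Fin n → ℂ) → Matrix (Fin n) (Fin n) ℂ} {y : Fin n → ℂ}
    (hA : ∀ i j, AnalyticAt ℂ (fun z => A z i j) y) (hdet : IsUnit (A y).det) (i j : Fin n) :
    AnalyticAt ℂ (fun z => (A z)⁻¹ i j) y := by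
  simp only [Matrix.inv_def, Ring.inverse_eq_inv', Matrix.smul_apply, smul_eq_mul,
    Matrix.adjugate_apply]
  refine ((analyticAt_det hA).inv hdet.ne_zero).mul (analyticAt_det fun a b => ?_)
  by_cases h : a = j
  · subst h; simpa using analyticAt_const
  · simpa [Matrix.updateRow_ne h] using hA a b

/-- Christoffel symbols of the first kind, `g(∇_{∂ᵢ} ∂ⱼ, ∂ₗ)`. -/
def christoffelFirst {n : ℕ} (G : (Fin n → ℂ) → Matrix (Fin n) (Fin n) ℂ) (l i j : Fin n)
    (y : Fin n → ℂ) : ℂ :=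
  (1 / 2) * (pderiv i (fun z => G z j l) y + pderiv j (fun z => G z i l) y
      - pderiv l (fun z => G z i j) y)

/-- The product `g(∇_{∂ᵢ} ∂ⱼ, ∇_{∂ₖ} ∂ₗ)` of Christoffel symbols. -/
def christoffelPair {n : ℕ} (G : (Fin n → ℂ) → Matrix (Fin n) (Fin n) ℂ) (i j k l : Fin n)
    (y : Fin n → ℂ) : ℂ :=
  ∑ a, christoffelFirst G a i j y * christoffel G a k l y

namespace IsLocalMetric

variable {n : ℕ} {G : (Fin n → ℂ) → Matrix (Fin n) (Fin n) ℂ} {S : Set (Fin n → ℂ)}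
  {y : Fin n → ℂ}

theorem inv_symm (hG : IsLocalMetric G S) (y : Fin n → ℂ) (i j : Fin n) :
    (G y)⁻¹ i j = (G y)⁻¹ j i := by
  have h : (G y).transpose = G y := by ext a b; exact hG.symm y b a
  conv_lhs => rw [← h, ← Matrix.transpose_nonsing_inv]
  rfl

theorem mul_inv_contract (hG : IsLocalMetric G S) (hy : y ∈ S) (v : Fin n → ℂ) (l : Fin n) :
    ∑ a, G y a l * ∑ m, (G y)⁻¹ a m * v m = v l := by
  have h : (G y).mulVec ((G y)⁻¹.mulVec v) = v := by
    rw [Matrix.mulVec_mulVec, Matrix.mul_nonsing_inv _ (hG.isUnit_det y hy), Matrix.one_mulVec]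
  simpa [Matrix.mulVec, dotProduct, hG.symm y l] using congrFun h l

theorem sum_inv_mul (hG : IsLocalMetric G S) (hy : y ∈ S) (i k : Fin n) :
    ∑ l, (G y)⁻¹ i l * G y l k = if i = k then 1 else 0 := by
  have h := congrFun (congrFun (Matrix.nonsing_inv_mul _ (hG.isUnit_det y hy)) i) k
  simpa [Matrix.mul_apply, Matrix.one_apply] using h

theorem christoffel_symm (hG : IsLocalMetric G S) (a i j : Fin n) :
    christoffel G a i j y = christoffel G a j i y := by
  have h : (fun z => G z i j) = fun z => G z j i := funext fun z => hG.symm z i j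
  have h' : ∀ l, pderiv l (fun z => G z i j) y = pderiv l (fun z => G z j i) y :=
    fun l => by rw [h]
  simp only [christoffel, h']
  congr 1
  exact Finset.sum_congr rfl fun l _ => by ring

theorem analyticAt_inv (hG : IsLocalMetric G S) (hy : y ∈ S) (i j : Fin n) :
    AnalyticAt ℂ (fun z => (G z)⁻¹ i j) y :=
  NullGeometry.analyticAt_inv (hG.analytic y hy) (hG.isUnit_det y hy) i j

theorem analyticAt_pderiv (hG : IsLocalMetric G S) (hy : y ∈ S) (l i j : Fin n) :
    AnalyticAt ℂ (fun z => pderiv l (fun z => G z i j) z) y :=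
  NullGeometry.analyticAt_pderiv l (hG.analytic y hy i j)

theorem analyticAt_christoffel (hG : IsLocalMetric G S) (hy : y ∈ S) (k i j : Fin n) :
    AnalyticAt ℂ (christoffel G k i j) y :=
  analyticAt_const.mul (Finset.analyticAt_fun_sum _ fun l _ => (hG.analyticAt_inv hy k l).mul
    (((hG.analyticAt_pderiv hy i j l).add (hG.analyticAt_pderiv hy j i l)).sub
      (hG.analyticAt_pderiv hy l i j)))

theorem analyticAt_riemannCoord (hG : IsLocalMetric G S) (hy : y ∈ S) (i j k l : Fin n) :
    AnalyticAt ℂ (riemannCoord G i j k l) y := by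
  have hΓ := fun a b c => hG.analyticAt_christoffel hy a b c
  refine Finset.analyticAt_fun_sum _ fun a _ => (hG.analytic y hy a l).mul
    (((NullGeometry.analyticAt_pderiv i (hΓ a j k)).sub
      (NullGeometry.analyticAt_pderiv j (hΓ a i k))).add ?_)
  exact Finset.analyticAt_fun_sum _ fun b _ =>
    ((hΓ a i b).mul (hΓ b j k)).sub ((hΓ a j b).mul (hΓ b i k))

theorem analyticAt_ricciCoord (hG : IsLocalMetric G S) (hy : y ∈ S) (j k : Fin n) :
    AnalyticAt ℂ (ricciCoord G j k) y :=
  Finset.analyticAt_fun_sum _ fun i _ => Finset.analyticAt_fun_sum _ fun l _ =>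
    (hG.analyticAt_inv hy i l).mul (hG.analyticAt_riemannCoord hy i j k l)

theorem analyticAt_scalarCoord (hG : IsLocalMetric G S) (hy : y ∈ S) :
    AnalyticAt ℂ (scalarCoord G) y :=
  Finset.analyticAt_fun_sum _ fun i _ => Finset.analyticAt_fun_sum _ fun l _ =>
    (hG.analyticAt_inv hy i l).mul (hG.analyticAt_ricciCoord hy i l)

theorem analyticAt_rhoCoord (hG : IsLocalMetric G S) (hy : y ∈ S) (j k : Fin n) :
    AnalyticAt ℂ (rhoCoord G j k) y :=
  analyticAt_const.mul ((hG.analyticAt_ricciCoord hy j k).sub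
    ((hG.analyticAt_scalarCoord hy).div_const.mul (hG.analytic y hy j k)))

theorem sum_mul_christoffel (hG : IsLocalMetric G S) (hy : y ∈ S) (l i j : Fin n) :
    ∑ a, G y a l * christoffel G a i j y = christoffelFirst G l i j y := by
  rw [christoffelFirst, ← hG.mul_inv_contract hy (fun l => (1 / 2) *
    (pderiv i (fun z => G z j l) y + pderiv j (fun z => G z i l) y
      - pderiv l (fun z => G z i j) y)) l]
  refine Finset.sum_congr rfl fun a _ => ?_
  rw [christoffel, Finset.mul_sum]
  congr 1
  exact Finset.sum_congr rfl fun m _ => by ring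

/-- This is ∇g = 0 in coordinates. It lets derivatives of the metric be traded for Christoffel
symbols of the first kind. -/
theorem pderiv_eq (hG : IsLocalMetric G S) (i j k : Fin n) :
    pderiv i (fun z => G z j k) y = christoffelFirst G k i j y + christoffelFirst G j i k y := by
  have h : (fun z => G z k j) = fun z => G z j k := funext fun z => hG.symm z k j
  rw [christoffelFirst, christoffelFirst, h]
  ring

theorem christoffelPair_symm (hG : IsLocalMetric G S) (hy : y ∈ S) (i j k l : Fin n) :
    christoffelPair G i j k l y = christoffelPair G k l i j y := by
  simp only [christoffelPair, ← hG.sum_mul_christoffel hy, Finset.sum_mul]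
  rw [Finset.sum_comm]
  refine Finset.sum_congr rfl fun a _ => Finset.sum_congr rfl fun b _ => ?_
  rw [hG.symm y a b]; ring

/-- The Riemann tensor in terms of second derivatives of the metric. -/
theorem riemannCoord_eq (hG : IsLocalMetric G S) (hy : y ∈ S) (i j k l : Fin n) :
    riemannCoord G i j k l y =
      (1 / 2) * (pderiv i (fun z => pderiv k (fun z => G z j l) z) y
        - pderiv i (fun z => pderiv l (fun z => G z j k) z) y
        - pderiv j (fun z => pderiv k (fun z => G z i l) z) y
        + pderiv j (fun z => pderiv l (fun z => G z i k) z) y)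
      - (christoffelPair G i l j k y - christoffelPair G j l i k y) := by
  have hd : ∀ i j k, pderiv i (christoffelFirst G l j k) y =
      ∑ a, (pderiv i (fun z => G z a l) y * christoffel G a j k y
        + G y a l * pderiv i (christoffel G a j k) y) := by
    intro i j k
    rw [pderiv_congr i hG.isOpen hy fun z hz => (hG.sum_mul_christoffel hz l j k).symm]
    exact (HasPderiv.sum fun a => (hasPderiv i (hG.analytic y hy a l)).mul
      (hasPderiv i (hG.analyticAt_christoffel hy a j k))).2
  have hf : ∀ i j k, pderiv i (christoffelFirst G l j k) y =
      (1 / 2) * (pderiv i (fun z => pderiv j (fun z => G z k l) z) y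
        + pderiv i (fun z => pderiv k (fun z => G z j l) z) y
        - pderiv i (fun z => pderiv l (fun z => G z j k) z) y) := by
    intro i j k
    exact ((((hasPderiv i (hG.analyticAt_pderiv hy j k l)).add
      (hasPderiv i (hG.analyticAt_pderiv hy k j l))).sub
      (hasPderiv i (hG.analyticAt_pderiv hy l j k))).const_mul (1 / 2)).2
  have hΓ : ∀ i j k, ∑ a, G y a l * ∑ b, christoffel G a i b y * christoffel G b j k y =
      ∑ b, christoffelFirst G l i b y * christoffel G b j k y := by
    intro i j k
    simp only [← hG.sum_mul_christoffel hy, Finset.mul_sum, Finset.sum_mul]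
    rw [Finset.sum_comm]
    exact Finset.sum_congr rfl fun a _ => Finset.sum_congr rfl fun b _ => by ring
  have hR : riemannCoord G i j k l y =
      pderiv i (christoffelFirst G l j k) y - pderiv j (christoffelFirst G l i k) y
        - (christoffelPair G i l j k y - christoffelPair G j l i k y) := by
    -- Leibniz: G ∂Γ = ∂(GΓ) - (∂G)Γ. By ∇g = 0 the last term splits in two: one half is a
    -- `christoffelPair`, the other cancels the ΓΓ term in the definition of the curvature.
    have e : ∀ i j k, ∑ a, G y a l * pderiv i (christoffel G a j k) y =
        pderiv i (christoffelFirst G l j k) y - christoffelPair G i l j k y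
          - ∑ a, G y a l * ∑ b, christoffel G a i b y * christoffel G b j k y := by
      intro i j k
      rw [hd, hΓ, christoffelPair, ← Finset.sum_sub_distrib, ← Finset.sum_sub_distrib]
      refine Finset.sum_congr rfl fun a _ => ?_
      rw [hG.pderiv_eq]; ring
    simp only [riemannCoord, mul_add, mul_sub, Finset.sum_add_distrib, Finset.sum_sub_distrib, e]
    ring
  have hc : pderiv i (fun z => pderiv j (fun z => G z k l) z) y =
      pderiv j (fun z => pderiv i (fun z => G z k l) z) y :=
    pderiv_comm i j (hG.analytic y hy k l)
  rw [hR, hf, hf, hc]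
  ring

/-- In the second-derivative formula the symmetry is visible term by term: partial derivatives
commute, and the pairing of Christoffel symbols is symmetric. No Bianchi identity is needed. -/
theorem riemannCoord_pair_symm (hG : IsLocalMetric G S) (hy : y ∈ S) (i j k l : Fin n) :
    riemannCoord G k l i j y = riemannCoord G i j k l y := by
  have hc : ∀ i j k l, pderiv i (fun z => pderiv j (fun z => G z k l) z) y =
      pderiv j (fun z => pderiv i (fun z => G z k l) z) y :=
    fun i j k l => pderiv_comm i j (hG.analytic y hy k l)
  have hs : ∀ k l, (fun z => G z k l) = fun z => G z l k :=
    fun k l => funext fun z => hG.symm z k l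
  have hpair : ∀ i j k l, christoffelPair G i j k l y = christoffelPair G j i k l y := by
    intro i j k l
    simp only [christoffelPair]
    refine Finset.sum_congr rfl fun a _ => ?_
    rw [christoffelFirst, christoffelFirst, hs i j]; ring
  have hpair' : ∀ i j k l, christoffelPair G i j k l y = christoffelPair G i j l k y :=
    fun i j k l => Finset.sum_congr rfl fun a _ => by rw [hG.christoffel_symm a k l]
  have h1 : christoffelPair G k j l i y = christoffelPair G i l j k y := by
    rw [hG.christoffelPair_symm hy, hpair, hpair' i l k j]
  have h2 : christoffelPair G l j k i y = christoffelPair G j l i k y := by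
    rw [hpair, hpair' j l k i]
  rw [hG.riemannCoord_eq hy, hG.riemannCoord_eq hy, hc k i, hc k j, hc l i, hc l j, hs l j, hs l i,
    hs k j, hs k i, h1, h2]
  ring

end IsLocalMetric

/-! ### Conformal change of a local metric -/

/-- The logarithmic derivative `υᵢ = ∂ᵢ log w`. -/
def logDeriv {n : ℕ} (w : (Fin n → ℂ) → ℂ) (i : Fin n) (y : Fin n → ℂ) : ℂ :=
  pderiv i w y * (w y)⁻¹

/-- The gradient `υᵏ = gᵏˡ υₗ` of `log w`. -/
def logGrad {n : ℕ} (G : (Fin n → ℂ) → Matrix (Fin n) (Fin n) ℂ) (w : (Fin n → ℂ) → ℂ) (k : Fin n)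
    (y : Fin n → ℂ) : ℂ :=
  ∑ l, (G y)⁻¹ k l * logDeriv w l y

/-- `υ(∇_{∂ᵢ} ∂ⱼ)`. -/
def logDerivChristoffel {n : ℕ} (G : (Fin n → ℂ) → Matrix (Fin n) (Fin n) ℂ)
    (w : (Fin n → ℂ) → ℂ) (i j : Fin n) (y : Fin n → ℂ) : ℂ :=
  ∑ a, christoffel G a i j y * logDeriv w a y

/-- `g(υ, υ)`. -/
def logGradSq {n : ℕ} (G : (Fin n → ℂ) → Matrix (Fin n) (Fin n) ℂ) (w : (Fin n → ℂ) → ℂ)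
    (y : Fin n → ℂ) : ℂ :=
  ∑ a, logDeriv w a y * logGrad G w a y

/-- The tensor `∇ᵢ υⱼ - υᵢ υⱼ + ½ g(υ, υ) gᵢⱼ` by which the Rho tensor changes. -/
def rhoShift {n : ℕ} (G : (Fin n → ℂ) → Matrix (Fin n) (Fin n) ℂ) (w : (Fin n → ℂ) → ℂ)
    (i j : Fin n) (y : Fin n → ℂ) : ℂ :=
  pderiv i (logDeriv w j) y - logDerivChristoffel G w i j y - logDeriv w i y * logDeriv w j y
    + (1 / 2) * (logGradSq G w y * G y i j)

/-- `G' = w² G` on `S`, for a nowhere vanishing analytic function `w`. -/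
structure IsLocalConformal {n : ℕ} (G G' : (Fin n → ℂ) → Matrix (Fin n) (Fin n) ℂ)
    (w : (Fin n → ℂ) → ℂ) (S : Set (Fin n → ℂ)) : Prop where
  left : IsLocalMetric G S
  right : IsLocalMetric G' S
  analytic : ∀ y ∈ S, AnalyticAt ℂ w y
  ne_zero : ∀ y ∈ S, w y ≠ 0
  eq : ∀ y, G' y = w y ^ 2 • G y

namespace IsLocalConformal

variable {n : ℕ} {G G' : (Fin n → ℂ) → Matrix (Fin n) (Fin n) ℂ} {w : (Fin n → ℂ) → ℂ}
  {S : Set (Fin n → ℂ)} {y : Fin n → ℂ}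

theorem apply (H : IsLocalConformal G G' w S) (y : Fin n → ℂ) (i j : Fin n) :
    G' y i j = w y * w y * G y i j := by
  rw [H.eq]; simp [sq]

theorem inv_apply (H : IsLocalConformal G G' w S) (hy : y ∈ S) (i j : Fin n) :
    (G' y)⁻¹ i j = (w y ^ 2)⁻¹ * (G y)⁻¹ i j := by
  have h : w y ^ 2 ≠ 0 := pow_ne_zero 2 (H.ne_zero y hy)
  let _ := invertibleOfNonzero h
  rw [H.eq, Matrix.inv_smul _ _ (H.left.isUnit_det y hy), Matrix.smul_apply, smul_eq_mul,
    invOf_eq_inv]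

theorem pderiv_eq (H : IsLocalConformal G G' w S) (hy : y ∈ S) (i : Fin n) :
    pderiv i w y = logDeriv w i y * w y := by
  rw [logDeriv, inv_mul_cancel_right₀ (H.ne_zero y hy)]

theorem hasPderiv_logDeriv (H : IsLocalConformal G G' w S) (hy : y ∈ S) (i j : Fin n) :
    HasPderiv i (logDeriv w j) (pderiv i (logDeriv w j) y) y :=
  hasPderiv i ((analyticAt_pderiv j (H.analytic y hy)).mul
    ((H.analytic y hy).inv (H.ne_zero y hy)))

/-- The form d log w is closed. -/
theorem pderiv_logDeriv_symm (H : IsLocalConformal G G' w S) (hy : y ∈ S) (i j : Fin n) :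
    pderiv i (logDeriv w j) y = pderiv j (logDeriv w i) y := by
  have h : ∀ i j, pderiv i (logDeriv w j) y = _ := fun i j =>
    ((hasPderiv i (analyticAt_pderiv j (H.analytic y hy))).mul
      ((hasPderiv i (H.analytic y hy)).inv (H.ne_zero y hy))).2
  rw [h, h, pderiv_comm i j (H.analytic y hy)]
  ring

theorem hasPderiv_metric (H : IsLocalConformal G G' w S) (hy : y ∈ S) (l i j : Fin n) :
    HasPderiv l (fun z => G' z i j)
      (w y * w y * (pderiv l (fun z => G z i j) y + 2 * logDeriv w l y * G y i j)) y := by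
  have h : (fun z => G' z i j) = fun z => w z * w z * G z i j := funext fun z => H.apply z i j
  have hw := hasPderiv l (H.analytic y hy)
  rw [H.pderiv_eq hy] at hw
  rw [h]
  convert (hw.mul hw).mul (hasPderiv l (H.left.analytic y hy i j)) using 1
  ring

theorem pderiv_pderiv_metric (H : IsLocalConformal G G' w S) (hy : y ∈ S) (k l i j : Fin n) :
    pderiv k (fun z => pderiv l (fun z => G' z i j) z) y =
      w y * w y * (pderiv k (fun z => pderiv l (fun z => G z i j) z) y
        + 2 * logDeriv w k y * pderiv l (fun z => G z i j) y
        + 2 * logDeriv w l y * pderiv k (fun z => G z i j) y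
        + (2 * pderiv k (logDeriv w l) y + 4 * (logDeriv w k y * logDeriv w l y)) * G y i j) := by
  have hw := hasPderiv k (H.analytic y hy)
  rw [H.pderiv_eq hy] at hw
  rw [pderiv_congr k H.left.isOpen hy fun z hz => (H.hasPderiv_metric hz l i j).2]
  refine ((hw.mul hw).mul ((hasPderiv k (H.left.analyticAt_pderiv hy l i j)).add
    (((H.hasPderiv_logDeriv hy k l).const_mul 2).mul
      (hasPderiv k (H.left.analytic y hy i j))))).2.trans ?_
  ring

theorem christoffelFirst_eq (H : IsLocalConformal G G' w S) (hy : y ∈ S) (l i j : Fin n) :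
    christoffelFirst G' l i j y = w y ^ 2 * (christoffelFirst G l i j y
      + logDeriv w i y * G y j l + logDeriv w j y * G y i l - logDeriv w l y * G y i j) := by
  rw [christoffelFirst, (H.hasPderiv_metric hy i j l).2, (H.hasPderiv_metric hy j i l).2,
    (H.hasPderiv_metric hy l i j).2, christoffelFirst]
  ring

theorem sum_metric_mul_logGrad (H : IsLocalConformal G G' w S) (hy : y ∈ S) (l : Fin n) :
    ∑ a, G y l a * logGrad G w a y = logDeriv w l y := by
  rw [← H.left.mul_inv_contract hy (fun l => logDeriv w l y) l]
  exact Finset.sum_congr rfl fun a _ => by rw [logGrad, H.left.symm y l a]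

/-- Raising the index in `christoffelFirst_eq`: the factor w² cancels against the inverse metric,
and g⁻¹g produces the Kronecker deltas. -/
theorem christoffel_eq (H : IsLocalConformal G G' w S) (hy : y ∈ S) (a i j : Fin n) :
    christoffel G' a i j y = christoffel G a i j y + (if a = i then logDeriv w j y else 0)
      + (if a = j then logDeriv w i y else 0) - G y i j * logGrad G w a y := by
  have h : ∀ G, christoffel G a i j y = ∑ l, (G y)⁻¹ a l * christoffelFirst G l i j y := by
    intro G
    rw [christoffel, Finset.mul_sum]
    exact Finset.sum_congr rfl fun l _ => by rw [christoffelFirst]; ring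
  have hδ : ∀ i, ∑ l, (G y)⁻¹ a l * G y i l = if a = i then 1 else 0 := by
    intro i
    simp only [H.left.symm y i]
    exact H.left.sum_inv_mul hy a i
  have hw := H.ne_zero y hy
  have e : ∀ l, (G' y)⁻¹ a l * christoffelFirst G' l i j y =
      (G y)⁻¹ a l * christoffelFirst G l i j y + logDeriv w i y * ((G y)⁻¹ a l * G y j l)
        + logDeriv w j y * ((G y)⁻¹ a l * G y i l)
        - G y i j * ((G y)⁻¹ a l * logDeriv w l y) := by
    intro l
    rw [H.inv_apply hy, H.christoffelFirst_eq hy]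
    field_simp
  rw [h, h]
  simp only [e, Finset.sum_sub_distrib, Finset.sum_add_distrib, ← Finset.mul_sum, hδ, logGrad]
  simp only [mul_ite, mul_one, mul_zero]
  ring

theorem christoffelPair_eq (H : IsLocalConformal G G' w S) (hy : y ∈ S) (i l j k : Fin n) :
    christoffelPair G' i l j k y = w y ^ 2 * (christoffelPair G i l j k y
      + christoffelFirst G j i l y * logDeriv w k y + christoffelFirst G k i l y * logDeriv w j y
      - G y j k * logDerivChristoffel G w i l y
      + logDeriv w i y * (christoffelFirst G l j k y + G y l j * logDeriv w k y
        + G y l k * logDeriv w j y - G y j k * logDeriv w l y)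
      + logDeriv w l y * (christoffelFirst G i j k y + G y i j * logDeriv w k y
        + G y i k * logDeriv w j y - G y j k * logDeriv w i y)
      - G y i l * (logDerivChristoffel G w j k y + 2 * (logDeriv w j y * logDeriv w k y)
        - G y j k * logGradSq G w y)) := by
  -- The product is expanded so that, after summing over `a`, every summand is a Kronecker delta or
  -- one of the named contractions.
  have e : ∀ a, christoffelFirst G' a i l y * christoffel G' a j k y = w y ^ 2 * (
      christoffelFirst G a i l y * christoffel G a j k y
      + (if a = j then christoffelFirst G a i l y * logDeriv w k y else 0)
      + (if a = k then christoffelFirst G a i l y * logDeriv w j y else 0)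
      - G y j k * (christoffelFirst G a i l y * logGrad G w a y)
      + logDeriv w i y * (G y l a * christoffel G a j k y
        + (if a = j then G y l a * logDeriv w k y else 0)
        + (if a = k then G y l a * logDeriv w j y else 0)
        - G y j k * (G y l a * logGrad G w a y))
      + logDeriv w l y * (G y i a * christoffel G a j k y
        + (if a = j then G y i a * logDeriv w k y else 0)
        + (if a = k then G y i a * logDeriv w j y else 0)
        - G y j k * (G y i a * logGrad G w a y))
      - G y i l * (christoffel G a j k y * logDeriv w a y
        + (if a = j then logDeriv w a y * logDeriv w k y else 0)
        + (if a = k then logDeriv w a y * logDeriv w j y else 0)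
        - G y j k * (logDeriv w a y * logGrad G w a y))) := by
    intro a
    rw [H.christoffelFirst_eq hy, H.christoffel_eq hy]
    split_ifs <;> ring
  have h1 : ∀ l, ∑ a, G y l a * christoffel G a j k y = christoffelFirst G l j k y := by
    intro l
    rw [← H.left.sum_mul_christoffel hy]
    exact Finset.sum_congr rfl fun a _ => by rw [H.left.symm y l a]
  have h2 : ∑ a, christoffelFirst G a i l y * logGrad G w a y = logDerivChristoffel G w i l y := by
    simp only [logDerivChristoffel, ← H.sum_metric_mul_logGrad hy, ← H.left.sum_mul_christoffel hy,
      Finset.mul_sum, Finset.sum_mul]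
    rw [Finset.sum_comm]
    exact Finset.sum_congr rfl fun a _ => Finset.sum_congr rfl fun b _ => by ring
  simp only [christoffelPair, e, ← Finset.mul_sum, Finset.sum_sub_distrib, Finset.sum_add_distrib,
    Finset.sum_ite_eq', Finset.mem_univ, if_true, h1, h2, H.sum_metric_mul_logGrad hy]
  simp only [logDerivChristoffel, logGradSq]
  ring

theorem logDerivChristoffel_symm (H : IsLocalConformal G G' w S) (i j : Fin n) :
    logDerivChristoffel G w i j y = logDerivChristoffel G w j i y :=
  Finset.sum_congr rfl fun a _ => by rw [H.left.christoffel_symm]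

/-- Both curvatures are compared through their second-derivative formulas, which never differentiate
an inverse metric; what remains is a polynomial identity. -/
theorem riemannCoord_eq (H : IsLocalConformal G G' w S) (hy : y ∈ S) (i j k l : Fin n) :
    riemannCoord G' i j k l y = w y ^ 2 * (riemannCoord G i j k l y
      + G y i k * rhoShift G w j l y - G y i l * rhoShift G w j k y
      - G y j k * rhoShift G w i l y + G y j l * rhoShift G w i k y) := by
  have hd : ∀ k l j, christoffelFirst G l j k y = (1 / 2) * (pderiv j (fun z => G z k l) y
      + pderiv k (fun z => G z j l) y - pderiv l (fun z => G z j k) y) := fun _ _ _ => rfl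
  have hs : ∀ m k l, pderiv m (fun z => G z k l) y = pderiv m (fun z => G z l k) y := by
    intro m k l
    rw [show (fun z => G z k l) = fun z => G z l k from funext fun z => H.left.symm z k l]
  rw [H.left.riemannCoord_eq hy, H.right.riemannCoord_eq hy]
  simp only [H.pderiv_pderiv_metric hy, H.christoffelPair_eq hy, rhoShift, hd]
  -- To `ring`, `G y i j` and `G y j i` are unrelated atoms, so one order is fixed for each pair of
  -- indices.
  simp only [H.left.symm y l k, H.left.symm y l j, H.left.symm y l i,
    H.left.symm y j i, hs _ l k, hs _ l j, hs _ l i, hs _ k j, hs _ k i,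
    hs _ j i]
  ring

end IsLocalConformal

/-! ### Symmetries of the Ricci, Rho and Weyl tensors -/

namespace IsLocalMetric

variable {n : ℕ} {G : (Fin n → ℂ) → Matrix (Fin n) (Fin n) ℂ} {S : Set (Fin n → ℂ)}
  {y : Fin n → ℂ}

theorem ricciCoord_symm (hG : IsLocalMetric G S) (hy : y ∈ S) (j k : Fin n) :
    ricciCoord G j k y = ricciCoord G k j y := by
  have hskew : ∀ i j k l, riemannCoord G j i k l y = -riemannCoord G i j k l y := by
    intro i j k l
    simp only [riemannCoord, ← Finset.sum_neg_distrib]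
    refine Finset.sum_congr rfl fun a _ => ?_
    simp only [Finset.sum_sub_distrib]
    ring
  -- Reversing all four indices combines pair symmetry with two skew swaps in the first pair, so
  -- skewness in the second pair is not needed separately.
  have h : ∀ i l, riemannCoord G i j k l y = riemannCoord G l k j i y := by
    intro i l
    have h1 := hG.riemannCoord_pair_symm hy i j k l
    have h2 := hG.riemannCoord_pair_symm hy i j l k
    have h3 := hG.riemannCoord_pair_symm hy l k j i
    linear_combination -h1 + hskew l k i j - h2 - hskew j i l k + h3
  rw [ricciCoord, ricciCoord, Finset.sum_comm]
  exact Finset.sum_congr rfl fun l _ => Finset.sum_congr rfl fun i _ => by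
    rw [hG.inv_symm y i l, h]

theorem rhoCoord_symm (hG : IsLocalMetric G S) (hy : y ∈ S) (j k : Fin n) :
    rhoCoord G j k y = rhoCoord G k j y := by
  rw [rhoCoord, rhoCoord, hG.ricciCoord_symm hy, hG.symm]

theorem weylCoord_pair_symm (hG : IsLocalMetric G S) (hy : y ∈ S) (i j k l : Fin n) :
    weylCoord G k l i j y = weylCoord G i j k l y := by
  rw [weylCoord, weylCoord, hG.riemannCoord_pair_symm hy, hG.rhoCoord_symm hy l j,
    hG.rhoCoord_symm hy l i, hG.rhoCoord_symm hy k j, hG.rhoCoord_symm hy k i, hG.symm y k i,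
    hG.symm y k j, hG.symm y l i, hG.symm y l j]
  ring

end IsLocalMetric

/-! ### Conformal change of the Ricci, Rho, Weyl and Cotton–York tensors -/

namespace IsLocalConformal

variable {n : ℕ} {G G' : (Fin n → ℂ) → Matrix (Fin n) (Fin n) ℂ} {w : (Fin n → ℂ) → ℂ}
  {S : Set (Fin n → ℂ)} {y : Fin n → ℂ}

theorem ricciCoord_eq (H : IsLocalConformal G G' w S) (hy : y ∈ S) (j k : Fin n) :
    ricciCoord G' j k y = ricciCoord G j k y - (n - 2) * rhoShift G w j k y
      - G y j k * ∑ i, ∑ l, (G y)⁻¹ i l * rhoShift G w i l y := by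
  have hw := H.ne_zero y hy
  -- The indices are ordered so that each product of metric and inverse metric contracts directly by
  -- `sum_inv_mul`; the factors w² and w⁻² cancel.
  have e : ∀ i l, (G' y)⁻¹ i l * riemannCoord G' i j k l y =
      (G y)⁻¹ i l * riemannCoord G i j k l y
      + (G y)⁻¹ l i * G y i k * rhoShift G w j l y
      - (G y)⁻¹ i l * G y l i * rhoShift G w j k y
      - G y j k * ((G y)⁻¹ i l * rhoShift G w i l y)
      + (G y)⁻¹ i l * G y l j * rhoShift G w i k y := by
    intro i l
    rw [H.inv_apply hy, H.riemannCoord_eq hy, H.left.symm y l j, H.left.symm y l i,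
      H.left.inv_symm y l i]
    field_simp
  have h1 : ∑ i, ∑ l, (G y)⁻¹ l i * G y i k * rhoShift G w j l y = rhoShift G w j k y := by
    rw [Finset.sum_comm]
    simp [← Finset.sum_mul, H.left.sum_inv_mul hy]
  have h2 : ∑ i, ∑ l, (G y)⁻¹ i l * G y l i * rhoShift G w j k y = n * rhoShift G w j k y := by
    simp [← Finset.sum_mul, H.left.sum_inv_mul hy]
  have h3 : ∑ i, ∑ l, (G y)⁻¹ i l * G y l j * rhoShift G w i k y = rhoShift G w j k y := by
    simp [← Finset.sum_mul, H.left.sum_inv_mul hy]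
  simp only [ricciCoord, e, Finset.sum_add_distrib, Finset.sum_sub_distrib, h1, h2, h3,
    ← Finset.mul_sum]
  ring

theorem scalarCoord_eq (H : IsLocalConformal G G' w S) (hy : y ∈ S) :
    w y ^ 2 * scalarCoord G' y = scalarCoord G y
      - 2 * (n - 1) * ∑ i, ∑ l, (G y)⁻¹ i l * rhoShift G w i l y := by
  have hw := H.ne_zero y hy
  set t := ∑ i, ∑ l, (G y)⁻¹ i l * rhoShift G w i l y with ht
  have e : ∀ i l, w y ^ 2 * ((G' y)⁻¹ i l * ricciCoord G' i l y) =
      (G y)⁻¹ i l * ricciCoord G i l y - (n - 2) * ((G y)⁻¹ i l * rhoShift G w i l y)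
      - (G y)⁻¹ i l * G y l i * t := by
    intro i l
    rw [H.inv_apply hy, H.ricciCoord_eq hy, H.left.symm y l i, ← ht]
    field_simp
  have h2 : ∑ i, ∑ l, (G y)⁻¹ i l * G y l i * t = n * t := by
    simp [← Finset.sum_mul, H.left.sum_inv_mul hy]
  simp only [scalarCoord, Finset.mul_sum, e, Finset.sum_sub_distrib, h2]
  simp only [← Finset.mul_sum, ← ht]
  ring

/-- The normalisation of the Rho tensor makes the trace term in the change of Ric cancel the one
coming from the scalar curvature. The bound on n keeps n - 1 and n - 2 nonzero. -/
theorem rhoCoord_eq (H : IsLocalConformal G G' w S) (hn : 3 ≤ n) (hy : y ∈ S) (i j : Fin n) :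
    rhoCoord G' i j y = rhoCoord G i j y - rhoShift G w i j y := by
  have h1 : (n : ℂ) - 1 ≠ 0 := by
    rw [sub_ne_zero]; exact_mod_cast (by lia : n ≠ 1)
  have h2 : (n : ℂ) - 2 ≠ 0 := by
    rw [sub_ne_zero]; exact_mod_cast (by lia : n ≠ 2)
  have hs := H.scalarCoord_eq hy
  have hw := H.ne_zero y hy
  have e : scalarCoord G' y / (2 * ((n : ℂ) - 1)) * G' y i j =
      scalarCoord G y / (2 * ((n : ℂ) - 1)) * G y i j
        - G y i j * ∑ i, ∑ l, (G y)⁻¹ i l * rhoShift G w i l y := by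
    rw [H.apply]
    field_simp
    linear_combination G y i j * hs
  rw [rhoCoord, rhoCoord, e, H.ricciCoord_eq hy]
  field_simp
  ring

/-- The curvature and its Rho part change by opposite multiples of the same expression in
`rhoShift`. -/
theorem weylCoord_eq (H : IsLocalConformal G G' w S) (hn : 3 ≤ n) (hy : y ∈ S) (i j k l : Fin n) :
    weylCoord G' i j k l y = w y ^ 2 * weylCoord G i j k l y := by
  simp only [weylCoord, H.rhoCoord_eq hn hy, H.riemannCoord_eq hy, H.apply]
  ring

theorem hasPderiv_logGrad (H : IsLocalConformal G G' w S) (hy : y ∈ S) (i k : Fin n) :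
    HasPderiv i (logGrad G w k) (pderiv i (logGrad G w k) y) y :=
  hasPderiv i (Finset.analyticAt_fun_sum _ fun l _ =>
    (H.left.analyticAt_inv hy k l).mul (H.hasPderiv_logDeriv hy i l).1)

/-- Metric compatibility: the derivative of g(υ, υ) is 2 g(∇ᵢυ, υ). Differentiating υ_a = g_ab υ^b
avoids any formula for the derivative of g⁻¹. -/
theorem hasPderiv_logGradSq (H : IsLocalConformal G G' w S) (hy : y ∈ S) (i : Fin n) :
    HasPderiv i (logGradSq G w) (2 * ∑ a, logGrad G w a y *
      (pderiv i (logDeriv w a) y - logDerivChristoffel G w i a y)) y := by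
  have h := HasPderiv.sum fun a => (H.hasPderiv_logDeriv hy i a).mul (H.hasPderiv_logGrad hy i a)
  refine ⟨h.1, h.2.trans ?_⟩
  have hd : ∀ a, pderiv i (logDeriv w a) y =
      ∑ b, (pderiv i (fun z => G z a b) y * logGrad G w b y
        + G y a b * pderiv i (logGrad G w b) y) := by
    intro a
    rw [pderiv_congr i H.left.isOpen hy fun z hz => (H.sum_metric_mul_logGrad hz a).symm]
    exact (HasPderiv.sum fun b => (hasPderiv i (H.left.analytic y hy a b)).mul
      (H.hasPderiv_logGrad hy i b)).2
  have hc : ∀ j, logDerivChristoffel G w i j y =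
      ∑ b, christoffelFirst G b i j y * logGrad G w b y := by
    intro j
    simp only [logDerivChristoffel, ← H.sum_metric_mul_logGrad hy, ← H.left.sum_mul_christoffel hy,
      Finset.mul_sum, Finset.sum_mul]
    rw [Finset.sum_comm]
    exact Finset.sum_congr rfl fun a _ => Finset.sum_congr rfl fun b _ => by ring
  have h1 : ∑ a, logGrad G w a y * pderiv i (logDeriv w a) y =
      2 * (∑ a, logGrad G w a y * logDerivChristoffel G w i a y)
        + ∑ a, logDeriv w a y * pderiv i (logGrad G w a) y := by
    have h2 : ∑ a, logDeriv w a y * pderiv i (logGrad G w a) y =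
        ∑ a, ∑ b, logGrad G w a y * (G y a b * pderiv i (logGrad G w b) y) := by
      rw [Finset.sum_comm]
      refine Finset.sum_congr rfl fun b _ => ?_
      rw [← H.sum_metric_mul_logGrad hy, Finset.sum_mul]
      exact Finset.sum_congr rfl fun a _ => by rw [H.left.symm y a b]; ring
    -- `h3` and `h4` write one sum with the summation indices exchanged. Adding the two copies
    -- symmetrises the Christoffel symbol of the first kind into ∂ᵢ g_ab.
    have h3 : ∑ a, logGrad G w a y * logDerivChristoffel G w i a y =
        ∑ a, ∑ b, logGrad G w a y * (christoffelFirst G a i b y * logGrad G w b y) := by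
      simp only [hc, Finset.mul_sum]
      rw [Finset.sum_comm]
      exact Finset.sum_congr rfl fun b _ => Finset.sum_congr rfl fun a _ => by ring
    have h4 : ∑ a, logGrad G w a y * logDerivChristoffel G w i a y =
        ∑ a, ∑ b, logGrad G w a y * (christoffelFirst G b i a y * logGrad G w b y) := by
      simp only [hc, Finset.mul_sum]
    rw [two_mul, h2]
    nth_rewrite 1 [h3]
    rw [h4]
    simp only [← Finset.sum_add_distrib, hd, Finset.mul_sum]
    refine Finset.sum_congr rfl fun a _ => Finset.sum_congr rfl fun b _ => ?_
    rw [H.left.pderiv_eq]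
    ring
  simp only [Finset.sum_add_distrib, mul_sub, Finset.sum_sub_distrib]
  have h5 : ∑ a, pderiv i (logDeriv w a) y * logGrad G w a y =
      ∑ a, logGrad G w a y * pderiv i (logDeriv w a) y :=
    Finset.sum_congr rfl fun a _ => mul_comm _ _
  rw [h5]
  linear_combination (-1) * h1

theorem hasPderiv_logDerivChristoffel (H : IsLocalConformal G G' w S) (hy : y ∈ S)
    (k i j : Fin n) :
    HasPderiv k (logDerivChristoffel G w i j)
      (∑ a, (pderiv k (christoffel G a i j) y * logDeriv w a y
        + christoffel G a i j y * pderiv k (logDeriv w a) y)) y :=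
  HasPderiv.sum fun a => (hasPderiv k (H.left.analyticAt_christoffel hy a i j)).mul
    (H.hasPderiv_logDeriv hy k a)

/-- The curvature term that the Ricci identity for υ produces when the derivative of `rhoShift` is
skew-symmetrised. -/
theorem sum_riemannCoord_mul_logGrad (H : IsLocalConformal G G' w S) (hy : y ∈ S)
    (i j k : Fin n) :
    ∑ l, riemannCoord G i j k l y * logGrad G w l y =
      ∑ a, (pderiv i (christoffel G a j k) y * logDeriv w a y)
      - ∑ a, (pderiv j (christoffel G a i k) y * logDeriv w a y)
      + ∑ b, christoffel G b j k y * logDerivChristoffel G w i b y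
      - ∑ b, christoffel G b i k y * logDerivChristoffel G w j b y := by
  simp only [riemannCoord, Finset.sum_mul]
  rw [Finset.sum_comm]
  have e : ∀ a, ∑ l, G y a l * (pderiv i (christoffel G a j k) y - pderiv j (christoffel G a i k) y
      + ∑ b, (christoffel G a i b y * christoffel G b j k y
        - christoffel G a j b y * christoffel G b i k y)) * logGrad G w l y =
      pderiv i (christoffel G a j k) y * logDeriv w a y
      - pderiv j (christoffel G a i k) y * logDeriv w a y
      + ∑ b, christoffel G b j k y * (christoffel G a i b y * logDeriv w a y)
      - ∑ b, christoffel G b i k y * (christoffel G a j b y * logDeriv w a y) := by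
    intro a
    have : ∀ l c, G y a l * c * logGrad G w l y = c * (G y a l * logGrad G w l y) :=
      fun l c => by ring
    simp only [this, ← Finset.mul_sum, H.sum_metric_mul_logGrad hy]
    rw [add_mul, sub_mul, Finset.sum_mul, add_sub_assoc, ← Finset.sum_sub_distrib]
    congr 1
    exact Finset.sum_congr rfl fun b _ => by ring
  rw [Finset.sum_congr rfl fun a _ => e a]
  simp only [Finset.sum_add_distrib, Finset.sum_sub_distrib, logDerivChristoffel, Finset.mul_sum]
  rw [Finset.sum_comm (f := fun a b => christoffel G b j k y * _),
    Finset.sum_comm (f := fun a b => christoffel G b i k y * _)]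

/-- Skew-symmetrising the covariant derivative of P - ∇υ + υ⊗υ - ½ g(υ, υ) g yields the curvature
contracted with υ, through commuted second derivatives. The corrections from the changed connection
supply the P terms that complete the curvature to the Weyl tensor; all else cancels. -/
theorem cottonCoord_eq (H : IsLocalConformal G G' w S) (hn : 3 ≤ n) (hy : y ∈ S) (i j k : Fin n) :
    cottonCoord G' i j k y = cottonCoord G i j k y
      + ∑ l, weylCoord G j k i l y * logGrad G w l y := by
  have hP : ∀ j k i, pderiv j (rhoCoord G' k i) y = pderiv j (rhoCoord G k i) y
      - (pderiv j (pderiv k (logDeriv w i)) y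
        - (∑ a, (pderiv j (christoffel G a k i) y * logDeriv w a y)
          + ∑ a, christoffel G a k i y * pderiv j (logDeriv w a) y)
        - (pderiv j (logDeriv w k) y * logDeriv w i y
          + logDeriv w k y * pderiv j (logDeriv w i) y)
        + (∑ a, logGrad G w a y * pderiv j (logDeriv w a) y
          - ∑ a, logGrad G w a y * logDerivChristoffel G w j a y) * G y k i
        + (1 / 2) * (logGradSq G w y * pderiv j (fun z => G z k i) y)) := by
    intro j k i
    rw [pderiv_congr j H.left.isOpen hy fun z hz => H.rhoCoord_eq hn hz k i]
    refine ((hasPderiv j (H.left.analyticAt_rhoCoord hy k i)).sub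
      ((((hasPderiv j (analyticAt_pderiv k (H.hasPderiv_logDeriv hy j i).1)).sub
        (H.hasPderiv_logDerivChristoffel hy j k i)).sub
        ((H.hasPderiv_logDeriv hy j k).mul (H.hasPderiv_logDeriv hy j i))).add
        (((H.hasPderiv_logGradSq hy j).mul
          (hasPderiv j (H.left.analytic y hy k i))).const_mul (1 / 2)))).2.trans ?_
    simp only [Finset.sum_add_distrib, mul_sub, Finset.sum_sub_distrib]
    ring
  -- Torsion-freeness removes the terms with Γᵃⱼₖ. The formula is stated for any local metric
  -- because it is applied to both `G` and `G'`.
  have hC : ∀ G S, IsLocalMetric G S → y ∈ S → cottonCoord G i j k y =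
      pderiv j (rhoCoord G k i) y - pderiv k (rhoCoord G j i) y
      - ∑ a, christoffel G a j i y * rhoCoord G k a y
      + ∑ a, christoffel G a k i y * rhoCoord G j a y := by
    intro G S hG hy
    have : ∀ a, christoffel G a k j y = christoffel G a j k y :=
      fun a => hG.christoffel_symm a k j
    simp only [cottonCoord, covRhoCoord, Finset.sum_add_distrib, this]
    ring
  -- The Rho tensor of `G'` stays unexpanded next to a Kronecker delta: of the two such terms, the
  -- one with indices `k j` drops out by symmetry after skew-symmetrisation.
  have hQ : ∀ j k, ∑ a, christoffel G' a j i y * rhoCoord G' k a y =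
      ∑ a, christoffel G a j i y * rhoCoord G k a y
      - ∑ a, christoffel G a j i y * pderiv k (logDeriv w a) y
      + ∑ a, christoffel G a j i y * logDerivChristoffel G w k a y
      + logDeriv w k y * logDerivChristoffel G w j i y
      - (1 / 2) * logGradSq G w y * christoffelFirst G k j i y
      + logDeriv w i y * rhoCoord G' k j y + logDeriv w j y * rhoCoord G' k i y
      - G y j i * (∑ a, logGrad G w a y * rhoCoord G k a y
        - ∑ a, logGrad G w a y * pderiv k (logDeriv w a) y
        + ∑ a, logGrad G w a y * logDerivChristoffel G w k a y
        + logDeriv w k y * logGradSq G w y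
        - (1 / 2) * logGradSq G w y * logDeriv w k y) := by
    intro j k
    have e : ∀ a, christoffel G' a j i y * rhoCoord G' k a y =
      christoffel G a j i y * rhoCoord G k a y
      - christoffel G a j i y * pderiv k (logDeriv w a) y
      + christoffel G a j i y * logDerivChristoffel G w k a y
      + logDeriv w k y * (christoffel G a j i y * logDeriv w a y)
      - (1 / 2) * logGradSq G w y * (G y a k * christoffel G a j i y)
      + (if a = j then logDeriv w i y * rhoCoord G' k a y else 0)
      + (if a = i then logDeriv w j y * rhoCoord G' k a y else 0)
      - G y j i * (logGrad G w a y * rhoCoord G k a y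
        - logGrad G w a y * pderiv k (logDeriv w a) y
        + logGrad G w a y * logDerivChristoffel G w k a y
        + logDeriv w k y * (logDeriv w a y * logGrad G w a y)
        - (1 / 2) * logGradSq G w y * (G y k a * logGrad G w a y)) := by
      intro a
      rw [H.christoffel_eq hy, H.rhoCoord_eq hn hy, rhoShift, H.left.symm y a k]
      split_ifs <;> ring
    simp only [e, Finset.sum_add_distrib, Finset.sum_sub_distrib, ← Finset.mul_sum,
      H.left.sum_mul_christoffel hy, H.sum_metric_mul_logGrad hy, Finset.sum_ite_eq',
      Finset.mem_univ, if_true]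
    simp only [logDerivChristoffel, logGradSq]
  have hW : ∑ l, weylCoord G j k i l y * logGrad G w l y =
      ∑ l, riemannCoord G j k i l y * logGrad G w l y
      + G y j i * ∑ a, logGrad G w a y * rhoCoord G k a y - logDeriv w j y * rhoCoord G k i y
      - G y k i * ∑ a, logGrad G w a y * rhoCoord G j a y + logDeriv w k y * rhoCoord G j i y := by
    have e : ∀ l, weylCoord G j k i l y * logGrad G w l y =
      riemannCoord G j k i l y * logGrad G w l y
      + G y j i * (logGrad G w l y * rhoCoord G k l y)
      - (G y j l * logGrad G w l y) * rhoCoord G k i y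
      - G y k i * (logGrad G w l y * rhoCoord G j l y)
      + (G y k l * logGrad G w l y) * rhoCoord G j i y := by
      intro l; rw [weylCoord]; ring
    simp only [e, Finset.sum_add_distrib, Finset.sum_sub_distrib, ← Finset.mul_sum,
      ← Finset.sum_mul, H.sum_metric_mul_logGrad hy]
  have hcomm : pderiv j (pderiv k (logDeriv w i)) y = pderiv k (pderiv j (logDeriv w i)) y :=
    pderiv_comm j k (H.hasPderiv_logDeriv hy i i).1
  have hd : ∀ j k, christoffelFirst G k j i y = (1 / 2) * (pderiv j (fun z => G z k i) y
      + pderiv i (fun z => G z j k) y - pderiv k (fun z => G z j i) y) := by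
    intro j k
    rw [christoffelFirst, show (fun z => G z i k) = fun z => G z k i from
      funext fun z => H.left.symm z i k]
  have hs : pderiv i (fun z => G z k j) y = pderiv i (fun z => G z j k) y := by
    rw [show (fun z => G z k j) = fun z => G z j k from funext fun z => H.left.symm z k j]
  rw [hC G' S H.right hy, hC G S H.left hy, hW, H.sum_riemannCoord_mul_logGrad hy, hQ, hQ, hP, hP,
    H.right.rhoCoord_symm hy k j, hd, hd, hs, hcomm, H.rhoCoord_eq hn hy k i,
    H.rhoCoord_eq hn hy j i, rhoShift, rhoShift, H.pderiv_logDeriv_symm hy k j]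
  ring

end IsLocalConformal

section Algebra

variable {V : Type*} [AddCommGroup V] [Module ℂ V]

/-! ### Rescaling the bilinear form -/

/-- Singular matrices are allowed, since their inverse is 0 by convention; hence the rescaling
lemmas need no non-degeneracy. -/
theorem inv_smul_matrix {n : ℕ} (A : Matrix (Fin n) (Fin n) ℂ) {c : ℂ} (hc : c ≠ 0) :
    (c • A)⁻¹ = c⁻¹ • A⁻¹ := by
  by_cases h : IsUnit A.det
  · let _ := invertibleOfNonzero hc
    rw [Matrix.inv_smul _ _ h, invOf_eq_inv]
  · have h' : ¬IsUnit (c • A).det := by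
      rw [Matrix.det_smul, isUnit_iff_ne_zero, not_not]
      rw [isUnit_iff_ne_zero, not_not] at h
      rw [h, mul_zero]
    rw [Matrix.nonsing_inv_apply_not_isUnit _ h, Matrix.nonsing_inv_apply_not_isUnit _ h',
      smul_zero]

theorem gram_inv_smul {n : ℕ} (B : LinearMap.BilinForm ℂ V) (b : Module.Basis (Fin n) ℂ V) {c : ℂ}
    (hc : c ≠ 0) (i j : Fin n) : (gram (c • B) b)⁻¹ i j = c⁻¹ * (gram B b)⁻¹ i j := by
  have h : gram (c • B) b = c • gram B b := by ext; simp [gram]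
  rw [h, inv_smul_matrix _ hc, Matrix.smul_apply, smul_eq_mul]

theorem orthogonal_smul (B : LinearMap.BilinForm ℂ V) (N : Submodule ℂ V) {c : ℂ} (hc : c ≠ 0) :
    (c • B).orthogonal N = B.orthogonal N := by
  ext v
  simp [LinearMap.BilinForm.mem_orthogonal_iff, hc]

theorem tensorFiltration_smul (n r : ℕ) (B : LinearMap.BilinForm ℂ V) (N : Submodule ℂ V) (k : ℚ)
    {c : ℂ} (hc : c ≠ 0) : tensorFiltration n r (c • B) N k = tensorFiltration n r B N k := by
  simp only [tensorFiltration, dualFiltration, nullFiltration, orthogonal_smul B N hc]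

theorem isWeylType_smul_iff {n : ℕ} {B : LinearMap.BilinForm ℂ V} {b : Module.Basis (Fin n) ℂ V}
    {T : (Fin 4 → V) → ℂ} {c : ℂ} (hc : c ≠ 0) : IsWeylType (c • B) b T ↔ IsWeylType B b T := by
  have h : ∀ Y Z, ∑ i, ∑ l, (gram (c • B) b)⁻¹ i l * T ![b i, Y, Z, b l] =
      c⁻¹ * ∑ i, ∑ l, (gram B b)⁻¹ i l * T ![b i, Y, Z, b l] := by
    intro Y Z
    simp only [gram_inv_smul B b hc, Finset.mul_sum, mul_assoc]
  constructor
  · rintro ⟨h1, h2, h3, h4, h5⟩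
    refine ⟨h1, h2, h3, h4, fun Y Z => ?_⟩
    have := h5 Y Z
    rw [h] at this
    exact (mul_eq_zero.mp this).resolve_left (inv_ne_zero hc)
  · rintro ⟨h1, h2, h3, h4, h5⟩
    exact ⟨h1, h2, h3, h4, fun Y Z => by rw [h, h5, mul_zero]⟩

theorem isCottonType_smul_iff {n : ℕ} {B : LinearMap.BilinForm ℂ V} {b : Module.Basis (Fin n) ℂ V}
    {T : (Fin 3 → V) → ℂ} {c : ℂ} (hc : c ≠ 0) :
    IsCottonType (c • B) b T ↔ IsCottonType B b T := by
  have h : ∀ Z, ∑ i, ∑ j, (gram (c • B) b)⁻¹ i j * T ![b i, b j, Z] =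
      c⁻¹ * ∑ i, ∑ j, (gram B b)⁻¹ i j * T ![b i, b j, Z] := by
    intro Z
    simp only [gram_inv_smul B b hc, Finset.mul_sum, mul_assoc]
  constructor
  · rintro ⟨h1, h2, h3⟩
    refine ⟨h1, h2, fun Z => ?_⟩
    have := h3 Z
    rw [h] at this
    exact (mul_eq_zero.mp this).resolve_left (inv_ne_zero hc)
  · rintro ⟨h1, h2, h3⟩
    exact ⟨h1, h2, fun Z => by rw [h, h3, mul_zero]⟩

theorem weylSpace_smul {n : ℕ} (B : LinearMap.BilinForm ℂ V) (b : Module.Basis (Fin n) ℂ V)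
    (N : Submodule ℂ V) (k : ℚ) {c : ℂ} (hc : c ≠ 0) :
    weylSpace (c • B) b N k = weylSpace B b N k := by
  simp only [weylSpace, tensorFiltration_smul _ _ B N k hc, isWeylType_smul_iff hc]

theorem cottonSpace_smul {n : ℕ} (B : LinearMap.BilinForm ℂ V) (b : Module.Basis (Fin n) ℂ V)
    (N : Submodule ℂ V) (k : ℚ) {c : ℂ} (hc : c ≠ 0) :
    cottonSpace (c • B) b N k = cottonSpace B b N k := by
  simp only [cottonSpace, tensorFiltration_smul _ _ B N k hc, isCottonType_smul_iff hc]

/-- The two inverse metrics contribute c⁻², which the volume form compensates. It is used with c =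
Ω², so that c² = Ω⁴ is the prescribed factor. -/
theorem hodge_smul (B : LinearMap.BilinForm ℂ V) (b : Module.Basis (Fin 4) ℂ V)
    (vol : V [⋀^Fin 4]→ₗ[ℂ] ℂ) {c : ℂ} (hc : c ≠ 0) :
    hodge (c • B) b (c ^ 2 • vol) = hodge B b vol := by
  funext η X Y
  simp only [hodge, gram_inv_smul B b hc, AlternatingMap.smul_apply, smul_eq_mul]
  congr 1
  refine Finset.sum_congr rfl fun i _ => Finset.sum_congr rfl fun j _ =>
    Finset.sum_congr rfl fun k _ => Finset.sum_congr rfl fun l _ => ?_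
  field_simp

theorem hodgeSlots_smul {r : ℕ} (B : LinearMap.BilinForm ℂ V) (b : Module.Basis (Fin 4) ℂ V)
    (vol : V [⋀^Fin 4]→ₗ[ℂ] ℂ) (s t : Fin r) {c : ℂ} (hc : c ≠ 0) :
    hodgeSlots (c • B) b (c ^ 2 • vol) s t = hodgeSlots B b vol s t := by
  funext T X
  simp only [hodgeSlots, hodge_smul B b vol hc]

theorem selfDualPart_smul {r : ℕ} (B : LinearMap.BilinForm ℂ V) (b : Module.Basis (Fin 4) ℂ V)
    (vol : V [⋀^Fin 4]→ₗ[ℂ] ℂ) (s t : Fin r) {c : ℂ} (hc : c ≠ 0) :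
    selfDualPart (c • B) b (c ^ 2 • vol) s t = selfDualPart B b vol s t := by
  funext T X
  simp only [selfDualPart, hodgeSlots_smul B b vol s t hc]

theorem sdWeylSpace_smul (B : LinearMap.BilinForm ℂ V) (b : Module.Basis (Fin 4) ℂ V)
    (vol : V [⋀^Fin 4]→ₗ[ℂ] ℂ) (N : Submodule ℂ V) (k : ℚ) {c : ℂ} (hc : c ≠ 0) :
    sdWeylSpace (c • B) b (c ^ 2 • vol) N k = sdWeylSpace B b vol N k := by
  simp only [sdWeylSpace, weylSpace_smul B b N k hc, hodgeSlots_smul B b vol _ _ hc]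

theorem sdCottonSpace_smul (B : LinearMap.BilinForm ℂ V) (b : Module.Basis (Fin 4) ℂ V)
    (vol : V [⋀^Fin 4]→ₗ[ℂ] ℂ) (N : Submodule ℂ V) (k : ℚ) {c : ℂ} (hc : c ≠ 0) :
    sdCottonSpace (c • B) b (c ^ 2 • vol) N k = sdCottonSpace B b vol N k := by
  simp only [sdCottonSpace, cottonSpace_smul B b N k hc, hodgeSlots_smul B b vol _ _ hc]

/-! ### Linearity of the Hodge operator and of the spaces of tensors -/

theorem hodge_add (B : LinearMap.BilinForm ℂ V) (b : Module.Basis (Fin 4) ℂ V)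
    (vol : V [⋀^Fin 4]→ₗ[ℂ] ℂ) (η θ : V → V → ℂ) :
    hodge B b vol (η + θ) = hodge B b vol η + hodge B b vol θ := by
  funext X Y
  simp only [hodge, Pi.add_apply, mul_add, Finset.sum_add_distrib]

theorem hodge_const_smul (B : LinearMap.BilinForm ℂ V) (b : Module.Basis (Fin 4) ℂ V)
    (vol : V [⋀^Fin 4]→ₗ[ℂ] ℂ) (a : ℂ) (η : V → V → ℂ) :
    hodge B b vol (a • η) = a • hodge B b vol η := by
  funext X Y
  simp only [hodge, Pi.smul_apply, smul_eq_mul, Finset.mul_sum]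
  refine Finset.sum_congr rfl fun i _ => Finset.sum_congr rfl fun j _ =>
    Finset.sum_congr rfl fun k _ => Finset.sum_congr rfl fun l _ => ?_
  ring

theorem hodgeSlots_add {r : ℕ} (B : LinearMap.BilinForm ℂ V) (b : Module.Basis (Fin 4) ℂ V)
    (vol : V [⋀^Fin 4]→ₗ[ℂ] ℂ) (s t : Fin r) (T T' : (Fin r → V) → ℂ) :
    hodgeSlots B b vol s t (T + T') = hodgeSlots B b vol s t T + hodgeSlots B b vol s t T' := by
  funext X
  exact congrFun (congrFun (hodge_add B b vol _ _) _) _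

theorem hodgeSlots_const_smul {r : ℕ} (B : LinearMap.BilinForm ℂ V) (b : Module.Basis (Fin 4) ℂ V)
    (vol : V [⋀^Fin 4]→ₗ[ℂ] ℂ) (s t : Fin r) (a : ℂ) (T : (Fin r → V) → ℂ) :
    hodgeSlots B b vol s t (a • T) = a • hodgeSlots B b vol s t T := by
  funext X
  exact congrFun (congrFun (hodge_const_smul B b vol a _) _) _

theorem selfDualPart_add {r : ℕ} (B : LinearMap.BilinForm ℂ V) (b : Module.Basis (Fin 4) ℂ V)
    (vol : V [⋀^Fin 4]→ₗ[ℂ] ℂ) (s t : Fin r) (T T' : (Fin r → V) → ℂ) :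
    selfDualPart B b vol s t (T + T') = selfDualPart B b vol s t T + selfDualPart B b vol s t T' := by
  funext X
  simp only [selfDualPart, hodgeSlots_add, Pi.add_apply]
  ring

theorem selfDualPart_const_smul {r : ℕ} (B : LinearMap.BilinForm ℂ V)
    (b : Module.Basis (Fin 4) ℂ V) (vol : V [⋀^Fin 4]→ₗ[ℂ] ℂ) (s t : Fin r) (a : ℂ)
    (T : (Fin r → V) → ℂ) :
    selfDualPart B b vol s t (a • T) = a • selfDualPart B b vol s t T := by
  funext X
  simp only [selfDualPart, hodgeSlots_const_smul, Pi.smul_apply, smul_eq_mul]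
  ring

theorem IsWeylType.smul {n : ℕ} {B : LinearMap.BilinForm ℂ V} {b : Module.Basis (Fin n) ℂ V}
    {T : (Fin 4 → V) → ℂ} (hT : IsWeylType B b T) (a : ℂ) : IsWeylType B b (a • T) where
  skew_left X Y Z W := by simp [hT.skew_left X Y Z W]
  skew_right X Y Z W := by simp [hT.skew_right X Y Z W]
  pair_symm X Y Z W := by simp [hT.pair_symm X Y Z W]
  cyclic X Y Z W := by
    simp only [Pi.smul_apply, smul_eq_mul, ← mul_add, hT.cyclic X Y Z W, mul_zero]
  trace_free Y Z := by
    simp only [Pi.smul_apply, smul_eq_mul, mul_left_comm _ a, ← Finset.mul_sum, hT.trace_free Y Z,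
      mul_zero]

theorem IsCottonType.smul {n : ℕ} {B : LinearMap.BilinForm ℂ V} {b : Module.Basis (Fin n) ℂ V}
    {T : (Fin 3 → V) → ℂ} (hT : IsCottonType B b T) (a : ℂ) : IsCottonType B b (a • T) where
  skew X Y Z := by simp [hT.skew X Y Z]
  cyclic X Y Z := by
    simp only [Pi.smul_apply, smul_eq_mul, ← mul_add, hT.cyclic X Y Z, mul_zero]
  trace_free Z := by
    simp only [Pi.smul_apply, smul_eq_mul, mul_left_comm _ a, ← Finset.mul_sum, hT.trace_free Z,
      mul_zero]

theorem IsCottonType.add {n : ℕ} {B : LinearMap.BilinForm ℂ V} {b : Module.Basis (Fin n) ℂ V}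
    {T T' : (Fin 3 → V) → ℂ} (hT : IsCottonType B b T) (hT' : IsCottonType B b T') :
    IsCottonType B b (T + T') where
  skew X Y Z := by simp only [Pi.add_apply, hT.skew X Y Z, hT'.skew X Y Z]; ring
  cyclic X Y Z := by
    simp only [Pi.add_apply]
    linear_combination hT.cyclic X Y Z + hT'.cyclic X Y Z
  trace_free Z := by
    simp only [Pi.add_apply, mul_add, Finset.sum_add_distrib, hT.trace_free Z, hT'.trace_free Z,
      add_zero]

theorem smul_mem_weylSpace {n : ℕ} {B : LinearMap.BilinForm ℂ V} {b : Module.Basis (Fin n) ℂ V}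
    {N : Submodule ℂ V} {k : ℚ} {T : (Fin 4 → V) → ℂ} (hT : T ∈ weylSpace B b N k) (a : ℂ) :
    a • T ∈ weylSpace B b N k :=
  ⟨Submodule.smul_mem _ a hT.1, hT.2.smul a⟩

theorem smul_mem_sdWeylSpace {B : LinearMap.BilinForm ℂ V} {b : Module.Basis (Fin 4) ℂ V}
    {vol : V [⋀^Fin 4]→ₗ[ℂ] ℂ} {N : Submodule ℂ V} {k : ℚ} {T : (Fin 4 → V) → ℂ}
    (hT : T ∈ sdWeylSpace B b vol N k) (a : ℂ) : a • T ∈ sdWeylSpace B b vol N k :=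
  ⟨smul_mem_weylSpace hT.1 a, by rw [hodgeSlots_const_smul, hT.2]⟩

theorem add_mem_cottonSpace_iff {n : ℕ} {B : LinearMap.BilinForm ℂ V}
    {b : Module.Basis (Fin n) ℂ V} {N : Submodule ℂ V} {k : ℚ} {T T' : (Fin 3 → V) → ℂ}
    (hT' : T' ∈ cottonSpace B b N k) : T + T' ∈ cottonSpace B b N k ↔ T ∈ cottonSpace B b N k := by
  refine ⟨fun h => ?_, fun h => ⟨Submodule.add_mem _ h.1 hT'.1, h.2.add hT'.2⟩⟩
  have e : T = (T + T') + (-1 : ℂ) • T' := by simp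
  rw [e]
  exact ⟨Submodule.add_mem _ h.1 (Submodule.smul_mem _ _ hT'.1), h.2.add (hT'.2.smul _)⟩

theorem add_mem_sdCottonSpace_iff {B : LinearMap.BilinForm ℂ V}
    {b : Module.Basis (Fin 4) ℂ V} {vol : V [⋀^Fin 4]→ₗ[ℂ] ℂ} {N : Submodule ℂ V} {k : ℚ}
    {T T' : (Fin 3 → V) → ℂ} (hT' : T' ∈ sdCottonSpace B b vol N k) :
    T + T' ∈ sdCottonSpace B b vol N k ↔ T ∈ sdCottonSpace B b vol N k := by
  simp only [sdCottonSpace, Set.mem_ofPred_eq, add_mem_cottonSpace_iff hT'.1, hodgeSlots_add, hT'.2,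
    add_left_inj]

/-! ### Monotonicity of the filtrations and contraction with a vector -/

theorem dualFiltration_antitone (n : ℕ) {B : LinearMap.BilinForm ℂ V} {N : Submodule ℂ V}
    (hN : N ≤ B.orthogonal N) : Antitone (dualFiltration n B N) := by
  have h : Antitone (nullFiltration n B N) := by
    intro i j hij
    simp only [nullFiltration]
    split_ifs <;> first | exact le_rfl | exact le_top | exact bot_le | exact hN | (exfalso; linarith)
  exact fun i j hij => Submodule.dualAnnihilator_anti (h (by linarith))

/-- Weights are spaced by 1, so a weight above (1 + ε)/2 is at least (3 + ε)/2. Then V^{1 - i} is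
already all of V, with zero annihilator. -/
theorem dualFiltration_eq_bot {n : ℕ} (B : LinearMap.BilinForm ℂ V) (N : Submodule ℂ V) {i : ℚ}
    (hi : IsWeight n i) (h : (1 + ((n % 2 : ℕ) : ℚ)) / 2 < i) : dualFiltration n B N i = ⊥ := by
  obtain ⟨z, rfl⟩ := hi
  have hz : ((n % 2 : ℕ) : ℚ) + 1 ≤ z := by
    generalize n % 2 = e at h ⊢
    have h1 : ((e : ℤ) : ℚ) < z := by rw [Int.cast_natCast]; linarith
    have h2 : (e : ℤ) + 1 ≤ z := Int.cast_lt.mp h1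
    exact_mod_cast h2
  rw [dualFiltration, nullFiltration, if_pos (by linarith), Submodule.dualAnnihilator_top]

/-- The whole shift is charged to the first factor, so there must be one; an integer shift keeps its
index a weight. -/
theorem tensorFiltration_le_sub_natCast {n r : ℕ} {B : LinearMap.BilinForm ℂ V}
    {N : Submodule ℂ V} (hN : N ≤ B.orthogonal N) (k : ℚ) (d : ℕ) :
    tensorFiltration n (r + 1) B N k ≤ tensorFiltration n (r + 1) B N (k - d) := by
  refine Submodule.span_mono ?_
  rintro T ⟨i, α, hi, hk, hα, rfl⟩
  refine ⟨fun j => if j = 0 then i j - d else i j, α, fun j => ?_, ?_, fun j => ?_, rfl⟩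
  · obtain ⟨z, hz⟩ := hi j
    by_cases hj : j = 0
    · exact ⟨z - d, by simp only [if_pos hj, hz]; push_cast; ring⟩
    · exact ⟨z, by simp only [if_neg hj, hz]⟩
  · rw [Fin.sum_univ_succ] at hk ⊢
    simp only [Fin.succ_ne_zero, if_false, if_true]
    linarith
  · refine dualFiltration_antitone n hN ?_ (hα j)
    dsimp only
    split_ifs
    · simp
    · exact le_rfl

/-- Contraction of a `4`-tensor with a vector in its last argument; the result is ordered so that
the pair of arguments `0`, `1` becomes the pair `1`, `2`. -/
def contractLast (v : V) : ((Fin 4 → V) → ℂ) →ₗ[ℂ] ((Fin 3 → V) → ℂ) where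
  toFun T X := T ![X 1, X 2, X 0, v]
  map_add' _ _ := rfl
  map_smul' _ _ := rfl

/-- On a decomposable tensor, contraction replaces the last factor by a number. Either its weight
exceeds (1 + ε)/2 and it vanishes, or at most (1 + ε)/2 is lost. -/
theorem contractLast_mem_tensorFiltration {n : ℕ} {B : LinearMap.BilinForm ℂ V}
    {N : Submodule ℂ V} (hN : N ≤ B.orthogonal N) {k : ℚ} {T : (Fin 4 → V) → ℂ}
    (hT : T ∈ tensorFiltration n 4 B N k) (v : V) :
    contractLast v T ∈ tensorFiltration n 3 B N (k - (1 + ((n % 2 : ℕ) : ℚ)) / 2) := by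
  have hle : tensorFiltration n 4 B N k ≤
      (tensorFiltration n 3 B N (k - (1 + ((n % 2 : ℕ) : ℚ)) / 2)).comap (contractLast v) := by
    refine Submodule.span_le.mpr ?_
    rintro T ⟨i, α, hi, hk, hα, rfl⟩
    rw [SetLike.mem_coe, Submodule.mem_comap]
    by_cases h : (1 + ((n % 2 : ℕ) : ℚ)) / 2 < i 3
    · have h0 : α 3 = 0 := by
        have := hα 3
        rwa [dualFiltration_eq_bot B N (hi 3) h, Submodule.mem_bot] at this
      convert Submodule.zero_mem _
      funext X
      simp [contractLast, Fin.prod_univ_four, h0]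
    -- The total weight must be exactly k - (1 + ε)/2, so the nonpositive surplus i₃ - (1 + ε)/2 is
    -- added to the weight of `α 2`, which also absorbs the scalar `α 3 v`.
    · refine Submodule.subset_span
        ⟨![i 2 + (i 3 - (1 + ((n % 2 : ℕ) : ℚ)) / 2), i 0, i 1], ![α 3 v • α 2, α 0, α 1],
          fun j => ?_, ?_, fun j => ?_, ?_⟩
      · fin_cases j
        · obtain ⟨z, hz⟩ := hi 2
          obtain ⟨z', hz'⟩ := hi 3
          refine ⟨z + z' - ((n % 2 : ℕ) : ℤ), ?_⟩
          generalize n % 2 = e at hz hz' ⊢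
          simp [hz, hz']
          ring
        · exact hi 0
        · exact hi 1
      · simp only [Fin.sum_univ_four] at hk
        simp [Fin.sum_univ_three]
        linarith
      · fin_cases j
        · exact Submodule.smul_mem _ _
            (dualFiltration_antitone n hN (by simp at h ⊢; linarith) (hα 2))
        · exact hα 0
        · exact hα 1
      · funext X
        simp [contractLast, Fin.prod_univ_four, Fin.prod_univ_three]
        ring
  exact hle hT

theorem contractLast_mem_cottonSpace {n : ℕ} {B : LinearMap.BilinForm ℂ V}
    {b : Module.Basis (Fin n) ℂ V} {N : Submodule ℂ V} (hN : N ≤ B.orthogonal N) {k : ℚ}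
    {T : (Fin 4 → V) → ℂ} (hT : T ∈ weylSpace B b N k) (v : V) :
    contractLast v T ∈ cottonSpace B b N (k - (1 + ((n % 2 : ℕ) : ℚ)) / 2) := by
  obtain ⟨hk, h⟩ := hT
  refine ⟨contractLast_mem_tensorFiltration hN hk v, ?_, ?_, ?_⟩
  · intro X Y Z
    exact h.skew_left Y Z X v
  · intro X Y Z
    have := h.cyclic X Y Z v
    simp only [contractLast, LinearMap.coe_mk, AddHom.coe_mk, Matrix.cons_val]
    linear_combination this
  · intro Z
    -- Pair symmetry and one skew swap turn this trace into minus the Weyl trace in the slots `v`,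
    -- `Z`.
    rw [← neg_eq_zero, ← h.trace_free v Z]
    simp only [← Finset.sum_neg_distrib]
    refine Finset.sum_congr rfl fun i _ => Finset.sum_congr rfl fun j _ => ?_
    have h1 := h.pair_symm (b j) Z (b i) v
    have h2 := h.skew_right (b i) v Z (b j)
    simp only [contractLast, LinearMap.coe_mk, AddHom.coe_mk, Matrix.cons_val]
    linear_combination (gram B b)⁻¹ i j * h1 - (gram B b)⁻¹ i j * h2

theorem hodgeSlots_contract (B : LinearMap.BilinForm ℂ V) (b : Module.Basis (Fin 4) ℂ V)
    (vol : V [⋀^Fin 4]→ₗ[ℂ] ℂ) (T : (Fin 4 → V) → ℂ) (v : V) :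
    hodgeSlots B b vol 1 2 (fun X : Fin 3 → V => T ![X 0, v, X 1, X 2]) =
      fun X => hodgeSlots B b vol 2 3 T ![X 0, v, X 1, X 2] := by
  funext X
  have h : ∀ Y Z, Function.update (Function.update ![X 0, v, X 1, X 2] 2 Y) 3 Z =
      ![X 0, v, Y, Z] := by
    intro Y Z
    funext j
    fin_cases j <;> simp [Function.update]
  simp only [hodgeSlots, h]
  simp [Function.update]

theorem selfDualPart_contract (B : LinearMap.BilinForm ℂ V) (b : Module.Basis (Fin 4) ℂ V)
    (vol : V [⋀^Fin 4]→ₗ[ℂ] ℂ) (T : (Fin 4 → V) → ℂ) (v : V) :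
    selfDualPart B b vol 1 2 (fun X : Fin 3 → V => T ![X 0, v, X 1, X 2]) =
      fun X => selfDualPart B b vol 2 3 T ![X 0, v, X 1, X 2] := by
  funext X
  simp only [selfDualPart, hodgeSlots_contract]

theorem contractLast_mem_sdCottonSpace {B : LinearMap.BilinForm ℂ V}
    {b : Module.Basis (Fin 4) ℂ V} {vol : V [⋀^Fin 4]→ₗ[ℂ] ℂ} {N : Submodule ℂ V}
    (hN : N ≤ B.orthogonal N) {k : ℚ} {T : (Fin 4 → V) → ℂ} (hT : T ∈ sdWeylSpace B b vol N k)
    (v : V) : contractLast v T ∈ sdCottonSpace B b vol N (k - 1 / 2) := by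
  -- Pair symmetry moves `v` into the first pair, leaving intact the pair on which the Hodge
  -- operator acts.
  have h : contractLast v T = fun X : Fin 3 → V => T ![X 0, v, X 1, X 2] :=
    funext fun X => hT.1.2.pair_symm (X 0) v (X 1) (X 2)
  refine ⟨?_, ?_⟩
  · have := contractLast_mem_cottonSpace hN hT.1 v
    norm_num at this ⊢
    exact this
  · rw [h, hodgeSlots_contract, hT.2]

end Algebra

theorem isUnit_det_of_nondegenerate {V : Type*} [AddCommGroup V] [Module ℂ V] {n : ℕ}
    (B : LinearMap.BilinForm ℂ V) (hsymm : ∀ u v, B u v = B v u)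
    (hB : ∀ u, (∀ v, B u v = 0) → u = 0) (L : (Fin n → ℂ) ≃ₗ[ℂ] V) :
    IsUnit (Matrix.of fun i j => B (L (Pi.single i 1)) (L (Pi.single j 1))).det := by
  rw [isUnit_iff_ne_zero]
  intro h0
  obtain ⟨v, hv0, hv⟩ := Matrix.exists_mulVec_eq_zero_iff.mpr h0
  have hsum : ∀ u : Fin n → ℂ, L u = ∑ i, u i • L (Pi.single i 1) := by
    intro u
    simp only [← map_smul, ← map_sum]
    simp [← Pi.single_smul, Finset.univ_sum_single]
  have h1 : ∀ i, B (L (Pi.single i 1)) (L v) = 0 := by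
    intro i
    have := congrFun hv i
    rw [hsum v, map_sum]
    simpa [Matrix.mulVec, dotProduct, mul_comm] using this
  have h2 : L v = 0 := by
    refine hB _ fun u => ?_
    rw [hsymm, ← L.apply_symm_apply u, hsum (L.symm u), map_sum, LinearMap.sum_apply]
    exact Finset.sum_eq_zero fun i _ => by rw [map_smul, LinearMap.smul_apply, h1, smul_zero]
  exact hv0 (by simpa using h2)

/-! ### Transfer from coordinates to the manifold -/

section Manifold

variable {n : ℕ} {M : Type*} [TopologicalSpace M] [ChartedSpace (Fin n → ℂ) M]

variable [IsManifold 𝓘(ℂ, Fin n → ℂ) ω M]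

theorem isLocalMetric_coordMatrix (g : HolomorphicMetric n M) (p : M) :
    IsLocalMetric (coordMatrix g.val p) (chart n p).target where
  isOpen := isOpen_extChartAt_target p
  analytic y hy i j := by
    have h := g.holomorphic p i j
    exact (h.contDiffAt ((isOpen_extChartAt_target p).mem_nhds hy)).analyticAt
  symm y i j := g.symm _ _ _
  isUnit_det y hy := by
    have : IsManifold 𝓘(ℂ, Fin n → ℂ) 1 M := IsManifold.of_le (n := ω) (by simp)
    -- The differential of the inverse chart is invertible on the whole target, so the coordinate
    -- fields form a basis there and non-degeneracy gives a nonzero determinant.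
    obtain ⟨L, hL⟩ := isInvertible_mfderivWithin_extChartAt_symm (I := 𝓘(ℂ, Fin n → ℂ)) hy
    have hc : ∀ i, coordVec p y i = L (Pi.single i (1 : ℂ) : Fin n → ℂ) := by
      intro i
      rw [ModelWithCorners.range_eq_univ, mfderivWithin_univ] at hL
      exact (congrArg (fun A : (Fin n → ℂ) →L[ℂ] Tan n ((chart n p).symm y) =>
        A (Pi.single i (1 : ℂ))) hL).symm
    have h := isUnit_det_of_nondegenerate _ (g.symm ((chart n p).symm y))
      (g.nondegenerate ((chart n p).symm y)) (n := n) L.toLinearEquiv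
    have e : coordMatrix g.val p y = Matrix.of fun i j => g.val ((chart n p).symm y)
        (L.toLinearEquiv (Pi.single i (1 : ℂ) : Fin n → ℂ))
        (L.toLinearEquiv (Pi.single j (1 : ℂ) : Fin n → ℂ)) := by
      ext i j
      change g.val _ (coordVec p y i) (coordVec p y j) = _
      rw [hc, hc]
      rfl
    rw [e]
    exact h

theorem IsConformalChange.isLocalConformal {g g' : HolomorphicMetric n M} {Ω : M → ℂ}
    (h : IsConformalChange g g' Ω) (p : M) :
    IsLocalConformal (coordMatrix g.val p) (coordMatrix g'.val p) (Ω ∘ (chart n p).symm)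
      (chart n p).target where
  left := isLocalMetric_coordMatrix g p
  right := isLocalMetric_coordMatrix g' p
  analytic y hy := by
    have h1 : ContMDiffAt 𝓘(ℂ, Fin n → ℂ) 𝓘(ℂ, Fin n → ℂ) ω (chart n p).symm y :=
      (contMDiffOn_extChartAt_symm p).contMDiffAt ((isOpen_extChartAt_target p).mem_nhds hy)
    exact (contMDiffAt_iff_contDiffAt.mp (h.holomorphic.contMDiffAt.comp y h1)).analyticAt
  ne_zero y _ := h.ne_zero _
  eq y := by
    ext i j
    simp [coordMatrix, h.eq]

theorem weyl_conformal {g g' : HolomorphicMetric n M} {Ω : M → ℂ} (h : IsConformalChange g g' Ω)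
    (hn : 3 ≤ n) (p : M) : weyl g' p = Ω p ^ 2 • weyl g p := by
  have hy : chart n p p ∈ (chart n p).target := mem_extChartAt_target p
  have hp : (Ω ∘ (chart n p).symm) (chart n p p) = Ω p :=
    congrArg Ω (extChartAt_to_inv p)
  funext X
  simp only [weyl, (h.isLocalConformal p).weylCoord_eq hn hy, hp, Pi.smul_apply, smul_eq_mul,
    Finset.mul_sum, mul_assoc]

theorem weyl_pair_symm (g : HolomorphicMetric n M) (p : M) (X Y Z W : Tan n p) :
    weyl g p ![Z, W, X, Y] = weyl g p ![X, Y, Z, W] := by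
  have hy : chart n p p ∈ (chart n p).target := mem_extChartAt_target p
  have e : ∀ F : Fin n → Fin n → Fin n → Fin n → ℂ,
      ∑ i, ∑ j, ∑ k, ∑ l, F i j k l = ∑ k, ∑ l, ∑ i, ∑ j, F i j k l := by
    intro F
    calc ∑ i, ∑ j, ∑ k, ∑ l, F i j k l
        = ∑ i, ∑ k, ∑ j, ∑ l, F i j k l := Finset.sum_congr rfl fun i _ => Finset.sum_comm
      _ = ∑ k, ∑ i, ∑ j, ∑ l, F i j k l := Finset.sum_comm
      _ = ∑ k, ∑ i, ∑ l, ∑ j, F i j k l := Finset.sum_congr rfl fun k _ =>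
          Finset.sum_congr rfl fun i _ => Finset.sum_comm
      _ = ∑ k, ∑ l, ∑ i, ∑ j, F i j k l := Finset.sum_congr rfl fun k _ => Finset.sum_comm
  simp only [weyl]
  rw [e]
  refine Finset.sum_congr rfl fun i _ => Finset.sum_congr rfl fun j _ =>
    Finset.sum_congr rfl fun k _ => Finset.sum_congr rfl fun l _ => ?_
  rw [(isLocalMetric_coordMatrix g p).weylCoord_pair_symm hy]
  simp only [Matrix.cons_val]
  ring

theorem cotton_conformal {g g' : HolomorphicMetric n M} {Ω : M → ℂ} (h : IsConformalChange g g' Ω)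
    (hn : 3 ≤ n) (p : M) : ∃ v : Tan n p, cotton g' p = cotton g p + contractLast v (weyl g p) := by
  have hy : chart n p p ∈ (chart n p).target := mem_extChartAt_target p
  -- The vector is the gradient of log Ω; the tangent space at `p` is ℂⁿ by definition, so its
  -- components determine it directly.
  obtain ⟨v, hv⟩ : ∃ v : Tan n p, ∀ l, (coordBasis p).repr v l =
      logGrad (coordMatrix g.val p) (Ω ∘ (chart n p).symm) l (chart n p p) :=
    ⟨(fun l => logGrad (coordMatrix g.val p) (Ω ∘ (chart n p).symm) l (chart n p p) :
      Fin n → ℂ), fun _ => rfl⟩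
  refine ⟨v, ?_⟩
  funext X
  simp only [cotton, (h.isLocalConformal p).cottonCoord_eq hn hy, add_mul, Finset.sum_add_distrib,
    Pi.add_apply, contractLast, LinearMap.coe_mk, AddHom.coe_mk, weyl, Matrix.cons_val]
  congr 1
  rw [Finset.sum_comm]
  refine Finset.sum_congr rfl fun j _ => ?_
  rw [Finset.sum_comm]
  refine Finset.sum_congr rfl fun k _ => Finset.sum_congr rfl fun i _ => ?_
  rw [Finset.sum_mul]
  refine Finset.sum_congr rfl fun l _ => ?_
  rw [hv]
  ring

omit [IsManifold 𝓘(ℂ, Fin n → ℂ) ω M] in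
theorem IsConformalChange.inv {g g' : HolomorphicMetric n M} {Ω : M → ℂ}
    (h : IsConformalChange g g' Ω) : IsConformalChange g' g Ω⁻¹ where
  holomorphic := h.holomorphic.inv₀ h.ne_zero
  ne_zero p := inv_ne_zero (h.ne_zero p)
  eq p := by
    have := h.ne_zero p
    rw [h.eq, smul_smul, Pi.inv_apply, ← mul_pow, inv_mul_cancel₀ this, one_pow, one_smul]

theorem IsAlmostNull.conformal {g g' : HolomorphicMetric n M} {Ω : M → ℂ}
    {N : ∀ p : M, Submodule ℂ (Tan n p)} (hN : IsAlmostNull g N) (h : IsConformalChange g g' Ω) :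
    IsAlmostNull g' N where
  finrank_eq := hN.finrank_eq
  null p u hu v hv := by simp [h.eq, hN.null p u hu v hv]
  holomorphic := hN.holomorphic

theorem IsAlmostNull.le_orthogonal {g : HolomorphicMetric n M}
    {N : ∀ p : M, Submodule ℂ (Tan n p)} (hN : IsAlmostNull g N) (p : M) :
    N p ≤ (g.val p).orthogonal (N p) :=
  fun v hv u hu => hN.null p u hu v hv

omit [IsManifold 𝓘(ℂ, Fin n → ℂ) ω M] in
theorem isNullIntegrable_conformal_iff {g g' : HolomorphicMetric n M} {Ω : M → ℂ}
    (h : IsConformalChange g g' Ω) (N : ∀ p : M, Submodule ℂ (Tan n p)) (U : Set M) :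
    IsNullIntegrable g N U ↔ IsNullIntegrable g' N U := by
  simp only [IsNullIntegrable, h.eq, orthogonal_smul _ _ (pow_ne_zero 2 (h.ne_zero _))]

theorem weylIn_of_conformal {g g' : HolomorphicMetric n M} {Ω : M → ℂ}
    (h : IsConformalChange g g' Ω) (hn : 3 ≤ n) {N : ∀ p : M, Submodule ℂ (Tan n p)} {U : Set M}
    {k : ℚ} (hW : WeylIn g N U k) : WeylIn g' N U k := by
  intro p hp
  rw [weyl_conformal h hn, h.eq, weylSpace_smul _ _ _ _ (pow_ne_zero 2 (h.ne_zero p))]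
  exact smul_mem_weylSpace (hW p hp) _

theorem weylIn_conformal_iff {g g' : HolomorphicMetric n M} {Ω : M → ℂ}
    (h : IsConformalChange g g' Ω) (hn : 3 ≤ n) (N : ∀ p : M, Submodule ℂ (Tan n p)) (U : Set M)
    (k : ℚ) : WeylIn g N U k ↔ WeylIn g' N U k :=
  ⟨weylIn_of_conformal h hn, weylIn_of_conformal h.inv hn⟩

/-- Under a conformal change, the Cotton–York tensor changes by a contraction of the Weyl tensor,
which lies in `𝒜^{k - (1 + ε)/2}` and hence in all lower members of the filtration. -/
theorem cottonIn_conformal_iff {g g' : HolomorphicMetric n M} {Ω : M → ℂ}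
    (h : IsConformalChange g g' Ω) (hn : 3 ≤ n) {N : ∀ p : M, Submodule ℂ (Tan n p)}
    (hN : IsAlmostNull g N) {U : Set M} {k : ℚ} (hW : WeylIn g N U k) (d : ℕ) :
    CottonIn g N U (k - (1 + ((n % 2 : ℕ) : ℚ)) / 2 - d) ↔
      CottonIn g' N U (k - (1 + ((n % 2 : ℕ) : ℚ)) / 2 - d) := by
  refine forall₂_congr fun p hp => ?_
  obtain ⟨v, hv⟩ := cotton_conformal h hn p
  have hc := contractLast_mem_cottonSpace (hN.le_orthogonal p) (hW p hp) v
  rw [hv, h.eq, cottonSpace_smul _ _ _ _ (pow_ne_zero 2 (h.ne_zero p)), add_mem_cottonSpace_iff]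
  exact ⟨tensorFiltration_le_sub_natCast (hN.le_orthogonal p) _ d hc.1, hc.2⟩

/-! ### Conformal invariance of genericity -/

theorem eval_smul_of_isHomogeneous {σ : Type*} {F : MvPolynomial σ ℂ} {d : ℕ}
    (hF : F.IsHomogeneous d) (c : ℂ) (x : σ → ℂ) :
    MvPolynomial.eval (c • x) F = c ^ d * MvPolynomial.eval x F := by
  rw [MvPolynomial.eval_eq, MvPolynomial.eval_eq, Finset.mul_sum]
  refine Finset.sum_congr rfl fun m hm => ?_
  have h : ∑ i ∈ m.support, m i = d := by
    rw [← hF (MvPolynomial.mem_support_iff.mp hm), Finsupp.weight_apply]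
    simp [Finsupp.sum]
  simp only [Pi.smul_apply, smul_eq_mul, mul_pow, Finset.prod_mul_distrib]
  rw [Finset.prod_pow_eq_pow_sum, h]
  ring

/-- `T` is a bare function and the Weyl symmetries do not include linearity; its homogeneity comes
from the generating decomposable tensors. -/
theorem tensorFiltration_apply_smul {V : Type*} [AddCommGroup V] [Module ℂ V] {m r : ℕ}
    {B : LinearMap.BilinForm ℂ V} {N : Submodule ℂ V} {k : ℚ} {T : (Fin r → V) → ℂ}
    (hT : T ∈ tensorFiltration m r B N k) (c : ℂ) (X : Fin r → V) :
    T (fun j => c • X j) = c ^ r * T X := by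
  induction hT using Submodule.span_induction with
  | mem T hT =>
    obtain ⟨i, α, -, -, -, rfl⟩ := hT
    simp [Finset.prod_mul_distrib]
  | zero => simp
  | add T T' _ _ h h' => rw [Pi.add_apply, Pi.add_apply, h, h', mul_add]
  | smul a T _ h => rw [Pi.smul_apply, Pi.smul_apply, h, smul_eq_mul, smul_eq_mul]; ring

omit [IsManifold 𝓘(ℂ, Fin n → ℂ) ω M] in
theorem weyl_apply_smul (g : HolomorphicMetric n M) (p : M) (c : ℂ) (X : Fin 4 → Tan n p) :
    weyl g p (fun j => c • X j) = c ^ 4 * weyl g p X := by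
  simp only [weyl, map_smul, Finsupp.smul_apply, smul_eq_mul, Finset.mul_sum]
  refine Finset.sum_congr rfl fun i _ => Finset.sum_congr rfl fun j _ =>
    Finset.sum_congr rfl fun k _ => Finset.sum_congr rfl fun l _ => ?_
  ring

theorem IsAdaptedBasis.conformal {V : Type*} [AddCommGroup V] [Module ℂ V] {m : ℕ}
    {B : LinearMap.BilinForm ℂ V} {N : Submodule ℂ V} {e : NullIndex m → V}
    (he : IsAdaptedBasis B N e) {c : ℂ} (hc : c ≠ 0) :
    IsAdaptedBasis (c ^ 2 • B) N fun a => c⁻¹ • e a := by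
  refine ⟨fun a b => ?_, ?_⟩
  · rw [← he.1 a b]
    simp only [LinearMap.smul_apply, map_smul, smul_eq_mul]
    field_simp
  · rw [← he.2, Set.range_smul, Submodule.span_smul_eq_of_isUnit _ _ (inv_ne_zero hc).isUnit]

theorem isGeneric_of_conformal {g g' : HolomorphicMetric n M} {Ω : M → ℂ}
    (h : IsConformalChange g g' Ω) (hn : 3 ≤ n) {N : ∀ p : M, Submodule ℂ (Tan n p)} {U : Set M}
    {k : ℚ} (hg : IsGeneric g N U k) : IsGeneric g' N U k := by
  intro p hp
  obtain ⟨e, he, hb, hF⟩ := hg p hp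
  refine ⟨fun a q => (Ω q)⁻¹ • e a q, fun a => ?_, ?_, fun d F hd hz T hT => ?_⟩
  · exact ContMDiffAt.smul_section h.inv.holomorphic.contMDiffAt (he a)
  · filter_upwards [hb] with q hq
    rw [h.eq]
    exact hq.conformal (h.ne_zero q)
  · rw [h.eq, weylSpace_smul _ _ _ _ (pow_ne_zero 2 (h.ne_zero p))] at hT
    have h1 : components T (fun a => (Ω p)⁻¹ • e a p) =
        ((Ω p)⁻¹ ^ 4) • components T fun a => e a p :=
      funext fun I => tensorFiltration_apply_smul hT.1 _ _
    -- In the frame rescaled by Ω⁻¹ the components change by Ω⁻². This factor varies with the point,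
    -- but homogeneity pulls it out of the relation as a nonvanishing power.
    have h2 : ∀ q, components (weyl g' q) (fun a => (Ω q)⁻¹ • e a q) =
        (Ω q ^ 2 * (Ω q)⁻¹ ^ 4) • components (weyl g q) fun a => e a q := by
      intro q
      funext I
      simp only [components, weyl_conformal h hn, Pi.smul_apply, weyl_apply_smul, smul_eq_mul]
      ring
    rw [h1, eval_smul_of_isHomogeneous hd, hF d F hd ?_ T hT, mul_zero]
    filter_upwards [hz] with q hq
    rw [h2, eval_smul_of_isHomogeneous hd] at hq
    refine (mul_eq_zero.mp hq).resolve_left (pow_ne_zero _ ?_)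
    exact mul_ne_zero (pow_ne_zero _ (h.ne_zero q)) (pow_ne_zero _ (inv_ne_zero (h.ne_zero q)))

theorem isGeneric_conformal_iff {g g' : HolomorphicMetric n M} {Ω : M → ℂ}
    (h : IsConformalChange g g' Ω) (hn : 3 ≤ n) (N : ∀ p : M, Submodule ℂ (Tan n p)) (U : Set M)
    (k : ℚ) : IsGeneric g N U k ↔ IsGeneric g' N U k :=
  ⟨isGeneric_of_conformal h hn, isGeneric_of_conformal h.inv hn⟩

end Manifold

/-! ### Self-dual parts in dimension four -/

section FourDim

variable {M : Type*} [TopologicalSpace M] [ChartedSpace (Fin 4 → ℂ) M]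

theorem HolOrientation.vol_conformal {g g' : HolomorphicMetric 4 M} {o : HolOrientation g}
    {o' : HolOrientation g'} {Ω : M → ℂ} (ho : ∀ p, o'.vol p = Ω p ^ 4 • o.vol p) (p : M) :
    o'.vol p = (Ω p ^ 2) ^ 2 • o.vol p := by
  rw [ho, ← pow_mul]

theorem isSelfDual_of_conformal {g g' : HolomorphicMetric 4 M} {Ω : M → ℂ}
    (h : IsConformalChange g g' Ω) {o : HolOrientation g} {o' : HolOrientation g'}
    (ho : ∀ p, o'.vol p = Ω p ^ 4 • o.vol p) {N : ∀ p : M, Submodule ℂ (Tan 4 p)}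
    (hN : IsSelfDual o N) : IsSelfDual o' N := by
  intro p u hu v hv
  have e : (fun X Y => g'.val p u X * g'.val p v Y - g'.val p u Y * g'.val p v X) =
      (Ω p ^ 4) • fun X Y => g.val p u X * g.val p v Y - g.val p u Y * g.val p v X := by
    funext X Y
    simp only [h.eq, LinearMap.smul_apply, smul_eq_mul, Pi.smul_apply]
    ring
  rw [e, h.eq, HolOrientation.vol_conformal ho, hodge_smul _ _ _ (pow_ne_zero 2 (h.ne_zero p)),
    hodge_const_smul, hN p u hu v hv]

theorem SDWeylIn.mono {g : HolomorphicMetric 4 M} {o : HolOrientation g}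
    {N : ∀ p : M, Submodule ℂ (Tan 4 p)} (hN : ∀ p, N p ≤ (g.val p).orthogonal (N p)) {U : Set M}
    {k : ℕ} (h : SDWeylIn o N U k) : SDWeylIn o N U 0 := by
  intro p hp
  obtain ⟨⟨h1, h2⟩, h3⟩ := h p hp
  have := tensorFiltration_le_sub_natCast (hN p) _ k h1
  rw [sub_self] at this
  exact ⟨⟨this, h2⟩, h3⟩

variable [IsManifold 𝓘(ℂ, Fin 4 → ℂ) ω M]

theorem sdWeylIn_conformal_iff {g g' : HolomorphicMetric 4 M} {Ω : M → ℂ}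
    (h : IsConformalChange g g' Ω) {o : HolOrientation g} {o' : HolOrientation g'}
    (ho : ∀ p, o'.vol p = Ω p ^ 4 • o.vol p) (N : ∀ p : M, Submodule ℂ (Tan 4 p)) (U : Set M)
    (k : ℚ) : SDWeylIn o N U k ↔ SDWeylIn o' N U k := by
  refine forall₂_congr fun p hp => ?_
  have hc : Ω p ^ 2 ≠ 0 := pow_ne_zero 2 (h.ne_zero p)
  rw [weyl_conformal h (by norm_num), h.eq, HolOrientation.vol_conformal ho,
    sdWeylSpace_smul _ _ _ _ _ hc, selfDualPart_smul _ _ _ _ _ hc, selfDualPart_const_smul]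
  refine ⟨fun hT => smul_mem_sdWeylSpace hT _, fun hT => ?_⟩
  have := smul_mem_sdWeylSpace hT (Ω p ^ 2)⁻¹
  rwa [smul_smul, inv_mul_cancel₀ hc, one_smul] at this

/-- Pair symmetry is used twice, for C and for ⁺C. The second comes from the assumed Weyl type of
⁺C, so it need not be shown that the self-dual projection preserves Weyl symmetries. -/
theorem selfDualPart_contractLast_weyl (g : HolomorphicMetric 4 M) (o : HolOrientation g) (p : M)
    (v : Tan 4 p)
    (hT : IsWeylType (g.val p) (coordBasis p)
      (selfDualPart (g.val p) (coordBasis p) (o.vol p) 2 3 (weyl g p))) :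
    selfDualPart (g.val p) (coordBasis p) (o.vol p) 1 2 (contractLast v (weyl g p)) =
      contractLast v (selfDualPart (g.val p) (coordBasis p) (o.vol p) 2 3 (weyl g p)) := by
  have h1 : contractLast v (weyl g p) = fun X => weyl g p ![X 0, v, X 1, X 2] :=
    funext fun X => weyl_pair_symm g p _ _ _ _
  rw [h1, selfDualPart_contract]
  exact funext fun X => (hT.pair_symm (X 0) v (X 1) (X 2)).symm

theorem sdCottonIn_conformal_iff {g g' : HolomorphicMetric 4 M} {Ω : M → ℂ}
    (h : IsConformalChange g g' Ω) {o : HolOrientation g} {o' : HolOrientation g'}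
    (ho : ∀ p, o'.vol p = Ω p ^ 4 • o.vol p) {N : ∀ p : M, Submodule ℂ (Tan 4 p)}
    (hN : IsAlmostNull g N) {U : Set M} {k : ℚ} (hW : SDWeylIn o N U k) :
    SDCottonIn o N U (k - 1 / 2) ↔ SDCottonIn o' N U (k - 1 / 2) := by
  refine forall₂_congr fun p hp => ?_
  have hc : Ω p ^ 2 ≠ 0 := pow_ne_zero 2 (h.ne_zero p)
  obtain ⟨v, hv⟩ := cotton_conformal h (by norm_num) p
  rw [hv, h.eq, HolOrientation.vol_conformal ho, sdCottonSpace_smul _ _ _ _ _ hc,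
    selfDualPart_smul _ _ _ _ _ hc, selfDualPart_add,
    selfDualPart_contractLast_weyl g o p v (hW p hp).1.2,
    add_mem_sdCottonSpace_iff (contractLast_mem_sdCottonSpace (hN.le_orthogonal p) (hW p hp) v)]

theorem sdWeylExactly_conformal_iff {g g' : HolomorphicMetric 4 M} {Ω : M → ℂ}
    (h : IsConformalChange g g' Ω) {o : HolOrientation g} {o' : HolOrientation g'}
    (ho : ∀ p, o'.vol p = Ω p ^ 4 • o.vol p) (N : ∀ p : M, Submodule ℂ (Tan 4 p)) (U : Set M)
    (k : ℚ) : SDWeylExactly o N U k ↔ SDWeylExactly o' N U k := by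
  rw [SDWeylExactly, SDWeylExactly, sdWeylIn_conformal_iff h ho, sdWeylIn_conformal_iff h ho]

theorem hypothesisC_conformal_iff {g g' : HolomorphicMetric 4 M} {Ω : M → ℂ}
    (h : IsConformalChange g g' Ω) {o : HolOrientation g} {o' : HolOrientation g'}
    (ho : ∀ p, o'.vol p = Ω p ^ 4 • o.vol p) {N : ∀ p : M, Submodule ℂ (Tan 4 p)}
    (hN : IsAlmostNull g N) {U : Set M} (hW : SDWeylIn o N U 0) :
    HypothesisC o N U ↔ HypothesisC o' N U := by
  have := sdCottonIn_conformal_iff h ho hN hW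
  rw [show (0 : ℚ) - 1 / 2 = -1 / 2 by norm_num] at this
  rw [HypothesisC, HypothesisC, this, isNullIntegrable_conformal_iff h]

theorem conclusionC_conformal_iff {g g' : HolomorphicMetric 4 M} {Ω : M → ℂ}
    (h : IsConformalChange g g' Ω) {o : HolOrientation g} {o' : HolOrientation g'}
    (ho : ∀ p, o'.vol p = Ω p ^ 4 • o.vol p) (N : ∀ p : M, Submodule ℂ (Tan 4 p)) (U : Set M) :
    ConclusionC o N U ↔ ConclusionC o' N U := by
  simp only [ConclusionC, sdWeylExactly_conformal_iff h ho]

/-- Each alternative (1)_k has k ≥ 0, and the filtration decreases. This supplies the degeneracy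
needed to move the hypothesis of (c) between the metrics. -/
theorem ConclusionC.sdWeylIn_zero {g : HolomorphicMetric 4 M} {o : HolOrientation g}
    {N : ∀ p : M, Submodule ℂ (Tan 4 p)} (hN : IsAlmostNull g N) {U : Set M}
    (h : ConclusionC o N U) : SDWeylIn o N U 0 := by
  obtain ⟨k, -, hk, -⟩ := h
  exact hk.mono hN.le_orthogonal

end FourDim

end NullGeometry

end

/-! ### Assembly of the theorem -/

open NullGeometry
theorem mainTheorem8 :
    -- dimension at least five
    (∀ (n : ℕ) (M : Type*) [TopologicalSpace M] [ChartedSpace (Fin n → ℂ) M]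
        [IsManifold 𝓘(ℂ, Fin n → ℂ) ω M] (g g' : HolomorphicMetric n M) (Ω : M → ℂ)
        (N : ∀ p : M, Submodule ℂ (Tan n p)) (U : Set M),
        5 ≤ n → IsConformalChange g g' Ω → IsAlmostNull g N → IsOpen U →
      -- the conformal invariance of the degeneracy of the Cotton–York tensor
      (Even n → ∀ k : ℕ, k ≤ 2 → WeylIn g N U k →
        (CottonIn g N U (k - 1 / 2) ↔ CottonIn g' N U (k - 1 / 2))) ∧
      (Odd n → ∀ k : ℕ, k ≤ 4 → WeylIn g N U k →
        (CottonIn g N U (k - 1) ↔ CottonIn g' N U (k - 1))) ∧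
      -- the conformal invariance of the other conditions
      IsAlmostNull g' N ∧
      (IsNullIntegrable g N U ↔ IsNullIntegrable g' N U) ∧
      (∀ k : ℕ, (Even n ∧ k ≤ 2 ∨ Odd n ∧ k ≤ 4) →
        (WeylIn g N U k ↔ WeylIn g' N U k) ∧
        (IsGeneric g N U k ↔ IsGeneric g' N U k) ∧
        -- the conformal invariance of the Goldberg–Sachs statements
        (CottonDegeneracy g N U k ↔ CottonDegeneracy g' N U k) ∧
        (GoldbergSachs g N U k ↔ GoldbergSachs g' N U k))) ∧
    -- dimension four
    (∀ (M : Type*) [TopologicalSpace M] [ChartedSpace (Fin 4 → ℂ) M]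
        [IsManifold 𝓘(ℂ, Fin 4 → ℂ) ω M] (g g' : HolomorphicMetric 4 M) (Ω : M → ℂ)
        (o : HolOrientation g) (o' : HolOrientation g')
        (N : ∀ p : M, Submodule ℂ (Tan 4 p)) (U : Set M),
        IsConformalChange g g' Ω → (∀ p, o'.vol p = Ω p ^ 4 • o.vol p) →
        IsAlmostNull g N → IsSelfDual o N → IsOpen U →
      (∀ k : ℕ, k ≤ 2 → SDWeylIn o N U k →
        (SDCottonIn o N U (k - 1 / 2) ↔ SDCottonIn o' N U (k - 1 / 2))) ∧
      IsAlmostNull g' N ∧ IsSelfDual o' N ∧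
      (IsNullIntegrable g N U ↔ IsNullIntegrable g' N U) ∧
      (∀ k : ℕ, k ≤ 2 →
        (SDWeylIn o N U k ↔ SDWeylIn o' N U k) ∧
        (SDWeylExactly o N U k ↔ SDWeylExactly o' N U k) ∧
        (GoldbergSachsA o N U k ↔ GoldbergSachsA o' N U k) ∧
        (GoldbergSachsB o N U k ↔ GoldbergSachsB o' N U k)) ∧
      (HypothesisC o N U ∧ ConclusionC o N U ↔ HypothesisC o' N U ∧ ConclusionC o' N U) ∧
      (SDWeylIn o N U 0 →
        (HypothesisC o N U ↔ HypothesisC o' N U) ∧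
        ((HypothesisC o N U → ConclusionC o N U) ↔
          (HypothesisC o' N U → ConclusionC o' N U)))) := by
  refine ⟨?_, ?_⟩
  · intro n M _ _ _ g g' Ω N U hn h hN _
    have hn' : 3 ≤ n := by lia
    have hcot := fun (k : ℚ) (hW : WeylIn g N U k) (d : ℕ) => cottonIn_conformal_iff h hn' hN hW d
    have hcot0 : ∀ k : ℚ, WeylIn g N U k → (CottonIn g N U (k - (1 + ((n % 2 : ℕ) : ℚ)) / 2) ↔
        CottonIn g' N U (k - (1 + ((n % 2 : ℕ) : ℚ)) / 2)) := by
      intro k hW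
      simpa using hcot k hW 0
    have hcot1 : ∀ k : ℚ, WeylIn g N U k → (CottonIn g N U (k - (3 + ((n % 2 : ℕ) : ℚ)) / 2) ↔
        CottonIn g' N U (k - (3 + ((n % 2 : ℕ) : ℚ)) / 2)) := by
      intro k hW
      -- The weaker Cotton–York level lies exactly one step of the filtration below the level of the
      -- error term.
      have e : k - (3 + ((n % 2 : ℕ) : ℚ)) / 2 = k - (1 + ((n % 2 : ℕ) : ℚ)) / 2 - (1 : ℕ) := by
        push_cast; ring
      rw [e]
      exact hcot k hW 1
    have hW := weylIn_conformal_iff h hn' N U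
    have hI := isNullIntegrable_conformal_iff h N U
    refine ⟨fun he k _ hk => ?_, fun ho k _ hk => ?_, hN.conformal h, hI,
      fun k _ => ⟨hW k, isGeneric_conformal_iff h hn' N U k, ?_, ?_⟩⟩
    · have := hcot0 k hk
      rw [Nat.even_iff.mp he] at this
      norm_num at this ⊢
      exact this
    · have := hcot0 k hk
      rw [Nat.odd_iff.mp ho] at this
      norm_num at this ⊢
      exact this
    · rw [CottonDegeneracy, CottonDegeneracy, ← hW, ← hI]
      exact and_congr (forall_congr' fun hk => hcot1 k hk)
        (forall_congr' fun hk => forall_congr' fun _ => hcot0 k hk)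
    · rw [GoldbergSachs, GoldbergSachs, ← hW, ← hI, ← isGeneric_conformal_iff h hn' N U k]
      exact forall_congr' fun hk => forall_congr' fun _ => imp_congr_left (hcot0 k hk)
  · intro M _ _ _ g g' Ω o o' N U h ho hN hS _
    have hI := isNullIntegrable_conformal_iff h N U
    have hE := sdWeylExactly_conformal_iff h ho N U
    have hA := fun (k : ℚ) (hW : SDWeylIn o N U k) => sdCottonIn_conformal_iff h ho hN hW
    have hC := conclusionC_conformal_iff h ho N U
    refine ⟨fun k _ hk => hA k hk, hN.conformal h, isSelfDual_of_conformal h ho hS, hI,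
      fun k _ => ⟨sdWeylIn_conformal_iff h ho N U k, hE k, ?_, ?_⟩, ?_, fun h0 => ?_⟩
    · rw [GoldbergSachsA, GoldbergSachsA, ← hE, ← hI]
      exact forall_congr' fun hk => forall_congr' fun _ => hA k hk.1
    · rw [GoldbergSachsB, GoldbergSachsB, ← hE, ← hI]
      exact forall_congr' fun hk => imp_congr_left (hA k hk.1)
    · rw [← hC]
      -- The hypotheses need only be compared when the conclusion holds, and then ⁺C lies in ⁺𝒞⁰.
      exact and_congr_left fun hc =>
        hypothesisC_conformal_iff h ho hN (hc.sdWeylIn_zero hN)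
    · have := hypothesisC_conformal_iff h ho hN h0
      exact ⟨this, by rw [this, hC]⟩
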